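/- Let $(\Omega,\mathcal F,P)$ be a non-atomic probability space (every event of positive probability contains an event of strictly smaller positive probability). Let $L^\infty_{++}$ be the set of $P$-a.s. bounded random variables $X$ that are strictly positive in the sense that $X\ge c$ $P$-a.s. for some constant $c>0$ (equivalently, $\log X\in L^\infty$), with $P$-a.s. equal variables identified. Let $\mathcal Q$ be the set of all probability measures on $(\Omega,\mathcal F)$ that are absolutely continuous with respect to $P$. A map $\tilde\rho\colon L^\infty_{++}\to[0,\infty]$ is called - monotone if $X\le Y$ $P$-a.s. implies $\tilde\rho(X)\le\tilde\rho(Y)$; - quasi-logconvex if $\tilde\rho(X^\alpha Y^{1-\alpha})\le\max\{\tilde\rho(X),\tilde\rho(Y)\}$ for all $X,Y\in L^\infty_{++}$ and $\alpha\in(0,1)$; - continuous from below if $\tilde\rho(X_n)\to\tilde\rho(X)$ whenever $X_n,X\in L^\infty_{++}$ and $X_n\uparrow X$ $P$-a.s.; - law invariant if $\tilde\rho(X)=\tilde\rho(Y)$ whenever $X$ and $Y$ have the same distribution under $P$. The dual function of $\tilde\rho$ is $$\mathcal R(t;Q)=\inf\{\tilde\rho(Y): Y\in L^\infty_{++},\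 \mathbb E_Q[\log Y]\ge t\},\qquad t\in\mathbb R,\ Q\in\mathcal Q.$$ A function $\mathcal R\colon\mathbb R\times\mathcal Q\to[0,\infty]$ is law invariant if for every $t$ one has $\mathcal R(t;Q)=\mathcal R(t;Q')$ whenever $\mathrm dQ/\mathrm dP$ and $\mathrm dQ'/\mathrm dP$ have the same distribution under $P$. Consider the representation $$(\ast)\qquad \tilde\rho(X)=\sup_{Q\in\mathcal Q}\mathcal R(\mathbb E_Q[\log X];Q)\quad\text{for all }X\in L^\infty_{++}.$$ **(a)** Let $\tilde\rho\colon L^\infty_{++}\to[0,\infty]$ be monotone, quasi-logconvex and continuous from below. Then $(\ast)$ holds with its dual function $\mathcal R$, and $\tilde\rho$ is law invariant if and only if $\mathcal R$ is law invariant. Conversely, let $\tilde\rho\colon L^\infty_{++}\to[0,\infty]$ be any map such that $(\ast)$ holds with its dual function $\mathcal R$ and such that $\mathcal R$ is law invariant. Then $\tilde\rho$ is monotone, quasi-logconvex and law invariant; if moreover $t\mapsto\mathcal R(t;Q)$ is left-continuous on $\mathbb R$ for every $Q\in\mathcal Q$, then $\tilde\rho$ is also continuous from below. **(b)** Let $\tilde\rho\colon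 L^\infty_{++}\to[0,\infty]$ be monotone, quasi-logconvex, continuous from below and law invariant. For each random variable $Z$ that occurs below let $q_Z\colon(0,1)\to\mathbb R$ be any quantile function of $Z$, that is, $P(Z<q_Z(\beta))\le\beta\le P(Z\le q_Z(\beta))$ for all $\beta\in(0,1)$. Then for all $X\in L^\infty_{++}$ and $Q\in\mathcal Q$ the function $\beta\mapsto\log(q_X(\beta))\,q_{\mathrm dQ/\mathrm dP}(\beta)$ is integrable on $(0,1)$, and $$\tilde\rho(X)=\sup_{Q\in\mathcal Q}\mathcal R\left(\int_0^1\log(q_X(\beta))\,q_{\frac{\mathrm dQ}{\mathrm dP}}(\beta)\,\mathrm d\beta;\,Q\right),\qquad X\in L^\infty_{++},$$ where $$\mathcal R(t;Q)=\inf\left\{\tilde\rho(Y): Y\in L^\infty_{++},\ \int_0^1\log(q_Y(\beta))\,q_{\frac{\mathrm dQ}{\mathrm dP}}(\beta)\,\mathrm d\beta\ge t\right\},\qquad t\in\mathbb R,\ Q\in\mathcal Q.$$ This $\mathcal R$ coincides with the dual function of $\tilde\rho$, and it is law invariant. -/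

import Mathlib

open MeasureTheory ProbabilityTheory Filter Topology Set
open scoped ENNReal

noncomputable section

namespace QLC

variable {Ω : Type*} [MeasurableSpace Ω]

/-- `P` is non-atomic: every measurable set of positive measure has a measurable subset of
strictly smaller positive measure. (This is stronger than points being null sets.) -/
def NonAtomic (P : Measure Ω) : Prop :=
  ∀ A : Set Ω, MeasurableSet A → 0 < P A →
    ∃ B : Set Ω, B ⊆ A ∧ MeasurableSet B ∧ 0 < P B ∧ P B < P A

/-- `L^∞_{++}`: (classes of) essentially bounded random variables that are strictly positive,
i.e. almost surely at least some constant `c > 0`. Equivalently, `log X ∈ L^∞`. -/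
abbrev LinfPP (P : Measure Ω) : Type _ :=
  {X : Lp ℝ ∞ P // ∃ c : ℝ, 0 < c ∧ ∀ᵐ ω ∂P, c ≤ X ω}

/-- `𝒬`: the probability measures on `Ω` that are absolutely continuous with respect to `P`. -/
abbrev DualMeasure (P : Measure Ω) : Type _ :=
  {Q : Measure Ω // IsProbabilityMeasure Q ∧ Q ≪ P}

/-- The density `dQ/dP`, as a real random variable. -/
def density {P : Measure Ω} (Q : DualMeasure P) : Ω → ℝ := fun ω => (Q.1.rnDeriv P ω).toReal

lemma bounds {P : Measure Ω} (X : LinfPP P) :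
    ∃ c C : ℝ, 0 < c ∧ 0 < C ∧ ∀ᵐ ω ∂P, c ≤ X.1 ω ∧ X.1 ω ≤ C := by
  obtain ⟨c, hc, hX⟩ := X.2
  refine ⟨c, max 1 (eLpNormEssSup X.1 P).toReal, hc, by positivity, ?_⟩
  have hfin : eLpNormEssSup X.1 P ≠ ∞ := by
    have := (Lp.memLp X.1).2
    rw [eLpNorm_exponent_top] at this
    exact this.ne
  filter_upwards [hX, ae_le_eLpNormEssSup (f := X.1) (μ := P)] with ω h1 h2
  refine ⟨h1, le_trans (le_trans (le_abs_self _) ?_) (le_max_right _ _)⟩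
  have h3 := ENNReal.toReal_mono hfin h2
  rwa [toReal_enorm, Real.norm_eq_abs] at h3

lemma aux_geom {P : Measure Ω} (X Y : LinfPP P) {a : ℝ} (h0 : 0 < a) (h1 : a < 1) :
    ∃ c C : ℝ, 0 < c ∧ 0 < C ∧
      ∀ᵐ ω ∂P, c ≤ X.1 ω ^ a * Y.1 ω ^ (1 - a) ∧ X.1 ω ^ a * Y.1 ω ^ (1 - a) ≤ C := by
  obtain ⟨c, C, hc, hC, hX⟩ := bounds X
  obtain ⟨d, D, hd, hD, hY⟩ := bounds Y
  refine ⟨c ^ a * d ^ (1 - a), C ^ a * D ^ (1 - a), by positivity, by positivity, ?_⟩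
  filter_upwards [hX, hY] with ω hx hy
  have hx0 : 0 < X.1 ω := hc.trans_le hx.1
  have hy0 : 0 < Y.1 ω := hd.trans_le hy.1
  have ha : 0 ≤ 1 - a := by linarith
  exact ⟨mul_le_mul (Real.rpow_le_rpow hc.le hx.1 h0.le) (Real.rpow_le_rpow hd.le hy.1 ha)
      (by positivity) (by positivity),
    mul_le_mul (Real.rpow_le_rpow hx0.le hx.2 h0.le) (Real.rpow_le_rpow hy0.le hy.2 ha)
      (by positivity) (by positivity)⟩

lemma memLp_geom {P : Measure Ω} (X Y : LinfPP P) {a : ℝ} (h0 : 0 < a) (h1 : a < 1) :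
    MemLp (fun ω => X.1 ω ^ a * Y.1 ω ^ (1 - a)) ∞ P := by
  obtain ⟨c, C, hc, hC, h⟩ := aux_geom X Y h0 h1
  refine memLp_top_of_bound ?_ C ?_
  · exact ((((Lp.aestronglyMeasurable X.1).aemeasurable).pow_const _).mul
      (((Lp.aestronglyMeasurable Y.1).aemeasurable).pow_const _)).aestronglyMeasurable
  · filter_upwards [h] with ω hω
    rw [Real.norm_eq_abs, abs_of_nonneg (hc.le.trans hω.1)]
    exact hω.2

/-- The weighted geometric mean `X^a Y^{1-a}` of two elements of `L^∞_{++}`. -/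
def geomMean {P : Measure Ω} (X Y : LinfPP P) (a : ℝ) (h0 : 0 < a) (h1 : a < 1) : LinfPP P :=
  ⟨(memLp_geom X Y h0 h1).toLp _, by
    obtain ⟨c, C, hc, hC, h⟩ := aux_geom X Y h0 h1
    refine ⟨c, hc, ?_⟩
    filter_upwards [h, (memLp_geom X Y h0 h1).coeFn_toLp] with ω hω he
    rw [he]
    exact hω.1⟩

/-- Monotonicity: `X ≤ Y` a.s. implies `ρ X ≤ ρ Y`. -/
def IsMonotone {P : Measure Ω} (ρ : LinfPP P → ℝ≥0∞) : Prop :=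
  ∀ X Y : LinfPP P, (∀ᵐ ω ∂P, X.1 ω ≤ Y.1 ω) → ρ X ≤ ρ Y

/-- Quasi-logconvexity. -/
def IsQuasiLogconvex {P : Measure Ω} (ρ : LinfPP P → ℝ≥0∞) : Prop :=
  ∀ (X Y : LinfPP P) (a : ℝ) (h0 : 0 < a) (h1 : a < 1),
    ρ (geomMean X Y a h0 h1) ≤ max (ρ X) (ρ Y)

/-- Continuity from below: `X_n ↑ X` a.s. implies `ρ (X_n) → ρ X`. -/
def IsContinuousFromBelow {P : Measure Ω} (ρ : LinfPP P → ℝ≥0∞) : Prop :=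
  ∀ (Xn : ℕ → LinfPP P) (X : LinfPP P),
    (∀ᵐ ω ∂P, Monotone (fun n => (Xn n).1 ω) ∧
      Tendsto (fun n => (Xn n).1 ω) atTop (𝓝 (X.1 ω))) →
    Tendsto (fun n => ρ (Xn n)) atTop (𝓝 (ρ X))

/-- Law invariance: `ρ X = ρ Y` whenever `X` and `Y` have the same distribution under `P`. -/
def IsLawInvariant {P : Measure Ω} (ρ : LinfPP P → ℝ≥0∞) : Prop :=
  ∀ X Y : LinfPP P, IdentDistrib X.1 Y.1 P P → ρ X = ρ Y

/-- Law invariance of `R(t; ·)` on `𝒬` for every real `t`: `R(t; Q) = R(t; Q')` whenever the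
densities `dQ/dP` and `dQ'/dP` have the same distribution under `P`. -/
def IsDualLawInvariant {P : Measure Ω} (R : ℝ → DualMeasure P → ℝ≥0∞) : Prop :=
  ∀ (t : ℝ) (Q Q' : DualMeasure P),
    IdentDistrib (density Q) (density Q') P P → R t Q = R t Q'

/-- `E_Q[log X]`. -/
def expLog {P : Measure Ω} (Q : DualMeasure P) (X : LinfPP P) : ℝ :=
  ∫ ω, Real.log (X.1 ω) ∂Q.1

/-- The dual function of `ρ`: `R(t; Q) = inf {ρ(Y) : Y ∈ L^∞_{++}, E_Q[log Y] ≥ t}`. -/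
def dualFunction {P : Measure Ω} (ρ : LinfPP P → ℝ≥0∞) (t : ℝ) (Q : DualMeasure P) : ℝ≥0∞ :=
  ⨅ (Y : LinfPP P) (_ : t ≤ expLog Q Y), ρ Y

/-- `ρ` is represented by `R`: `ρ(X) = sup_{Q ∈ 𝒬} R(E_Q[log X]; Q)` for all `X`. -/
def IsRepresentedBy {P : Measure Ω} (ρ : LinfPP P → ℝ≥0∞)
    (R : ℝ → DualMeasure P → ℝ≥0∞) : Prop :=
  ∀ X : LinfPP P, ρ X = ⨆ Q : DualMeasure P, R (expLog Q X) Q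

/-- `R(·; Q)` is continuous from below for every `Q`. -/
def IsDualContinuousFromBelow {P : Measure Ω} (R : ℝ → DualMeasure P → ℝ≥0∞) : Prop :=
  ∀ (Q : DualMeasure P) (t : ℝ), ContinuousWithinAt (fun s => R s Q) (Iic t) t

/-- `q` is a quantile function of `Z` under `P`: for every `β ∈ (0,1)`, the number `q β` is a
(not necessarily the smallest or the largest) `β`-quantile of `Z`. -/
def IsQuantileFunction (P : Measure Ω) (Z : Ω → ℝ) (q : ℝ → ℝ) : Prop :=
  ∀ β ∈ Ioo (0 : ℝ) 1,
    P {ω | Z ω < q β} ≤ ENNReal.ofReal β ∧ ENNReal.ofReal β ≤ P {ω | Z ω ≤ q β}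

/-- `∫_0^1 log (q β) · d β dβ`. -/
def quantileIntegral (q d : ℝ → ℝ) : ℝ := ∫ β in (0 : ℝ)..1, Real.log (q β) * d β

/-- The quantile-based infimum
`inf {ρ(Y) : Y ∈ L^∞_{++}, ∫_0^1 log (q_Y(β)) q_{dQ/dP}(β) dβ ≥ t}`, for given choices `qV`, `qD`
of the quantile functions of the elements of `L^∞_{++}` and of the densities. -/
def quantileDual {P : Measure Ω} (ρ : LinfPP P → ℝ≥0∞) (qV : LinfPP P → ℝ → ℝ)
    (qD : DualMeasure P → ℝ → ℝ) (t : ℝ) (Q : DualMeasure P) : ℝ≥0∞ :=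
  ⨅ (Y : LinfPP P) (_ : t ≤ quantileIntegral (qV Y) (qD Q)), ρ Y

end QLC

end

namespace QLC

variable {Ω : Type*} [MeasurableSpace Ω]

/-! In logarithms, quasi-logconvexity says that the sublevel sets {f : ρ(exp f) ≤ a} are convex, and
monotonicity and continuity from below say that they are solid downwards and closed under bounded
almost sure limits.

For a < ρ(X), such a set omits log X - ε for some ε > 0. `exists_dualMeasure_neg` then yields Q with
E_Q log Y < E_Q log X whenever ρ(Y) ≤ a, so the dual function at E_Q log X is at least a. The
opposite inequality is immediate, since X competes in its own infimum.

The difficulty is that the separating functional must be countably additive. Hahn–Banach in the norm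
of L^∞ alone does not ensure this, so the set to be separated is enlarged. Weak compactness in L²,
in the form of `exists_mem_of_antitone_convex`, gives levels e n > 0 such that every W ≥ 0 with -W
in the set violates E(W - (n+1))⁺ ≤ e n for some n (`IsAdmissible.exists_levels`). The convex set K
of all W ≥ 0 obeying every bound contains arbitrarily large multiples of indicators of sufficiently
small sets. A functional bounded on K is therefore small on small sets, and
`exists_measure_of_functional` turns it into a measure.

Law invariance rests on rearrangement. On a non-atomic space any law can be realised comonotonely
with a given variable (`NonAtomic.exists_comonotone`), and by the Hardy–Littlewood inequality
(`Comonotone.integral_mul_le`) comonotone pairs maximise E[fg] among pairs with given marginals.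
Rearranging Y transfers law invariance from ρ to the dual function, rearranging dQ/dP transfers it
back. The quantile integral is the maximum of E_Q log Y' over copies Y' of Y, whence (b). -/

/-- A function in `L^∞` is almost surely bounded. -/
theorem exists_ae_abs_le {P : Measure Ω} {f : Ω → ℝ} (hf : MemLp f ∞ P) :
    ∃ M : ℝ, ∀ᵐ ω ∂P, |f ω| ≤ M := by
  have hfin : eLpNormEssSup f P ≠ ∞ := by
    have := hf.2
    rw [eLpNorm_exponent_top] at this
    exact this.ne
  refine ⟨(eLpNormEssSup f P).toReal, ?_⟩
  filter_upwards [ae_le_eLpNormEssSup (f := f) (μ := P)] with ω h2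
  have h4 := ENNReal.toReal_mono hfin h2
  rwa [toReal_enorm, Real.norm_eq_abs] at h4

/-! ### Compactness of bounded convex sets -/

/-- A decreasing sequence of nonempty closed convex sets in a Hilbert space whose first member is
bounded has a common point. -/
theorem exists_mem_of_antitone_convex {H : Type*} [NormedAddCommGroup H] [InnerProductSpace ℝ H]
    [CompleteSpace H] (S : ℕ → Set H) (hanti : Antitone S) (hconv : ∀ n, Convex ℝ (S n))
    (hclosed : ∀ n, IsClosed (S n)) (hne : ∀ n, (S n).Nonempty) (M : ℝ)
    (hM : ∀ x ∈ S 0, ‖x‖ ≤ M) : ∃ x, ∀ n, x ∈ S n := by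
  have hmin : ∀ n, ∃ x ∈ S n, ∀ y ∈ S n, ‖x‖ ≤ ‖y‖ := by
    intro n
    obtain ⟨v, hv, hv'⟩ := exists_norm_eq_iInf_of_complete_convex (hne n)
      (hclosed n).isComplete (hconv n) (0 : H)
    refine ⟨v, hv, fun y hy => ?_⟩
    have h1 : (⨅ w : S n, ‖(0 : H) - w‖) ≤ ‖(0 : H) - y‖ :=
      ciInf_le ⟨0, by rintro _ ⟨w, rfl⟩; exact norm_nonneg _⟩ (⟨y, hy⟩ : S n)
    rw [← hv'] at h1
    simpa using h1
  choose x hxS hx using hmin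
  have hmono : Monotone (fun n => ‖x n‖) := fun m n hmn => hx m _ (hanti hmn (hxS n))
  have hbdd : ∀ n, ‖x n‖ ≤ M := fun n => hM _ (hanti (Nat.zero_le n) (hxS n))
  have hlim := tendsto_atTop_ciSup hmono ⟨M, by rintro _ ⟨n, rfl⟩; exact hbdd n⟩
  have hsq : CauchySeq (fun n => ‖x n‖ ^ 2) := (hlim.pow 2).cauchySeq
  -- The midpoint of x m and x n stays in S m, so its norm is at least ‖x m‖. The parallelogram law
  -- then makes the minimal-norm points Cauchy, as their norms increase to a limit.
  have key : ∀ m n, m ≤ n → ‖x m - x n‖ ^ 2 ≤ 2 * (‖x n‖ ^ 2 - ‖x m‖ ^ 2) := by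
    intro m n hmn
    have hmid : (1 / 2 : ℝ) • x m + (1 / 2 : ℝ) • x n ∈ S m :=
      hconv m (hxS m) (hanti hmn (hxS n)) (by norm_num) (by norm_num) (by norm_num)
    have h1 := hx m _ hmid
    rw [← smul_add, norm_smul] at h1
    have h2 := parallelogram_law_with_norm ℝ (x m) (x n)
    norm_num at h1
    nlinarith [norm_nonneg (x m), norm_nonneg (x m + x n)]
  have hc : CauchySeq x := by
    rw [Metric.cauchySeq_iff']
    intro ε hε
    obtain ⟨N, hN⟩ := Metric.cauchySeq_iff'.1 hsq (ε ^ 2 / 2) (by positivity)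
    refine ⟨N, fun n hn => ?_⟩
    have h1 := hN n hn
    rw [Real.dist_eq] at h1
    have h2 := key N n hn
    have h3 := le_abs_self (‖x n‖ ^ 2 - ‖x N‖ ^ 2)
    rw [dist_comm, dist_eq_norm]
    exact lt_of_pow_lt_pow_left₀ 2 hε.le (by linarith)
  obtain ⟨y, hy⟩ := cauchySeq_tendsto_of_complete hc
  exact ⟨y, fun n => (hclosed n).mem_of_tendsto hy
    (eventually_atTop.2 ⟨n, fun k hk => hanti hk (hxS k)⟩)⟩

/-- `C` is closed under almost sure limits of uniformly bounded sequences. -/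
def FatouClosed (P : Measure Ω) (C : Set (Ω → ℝ)) : Prop :=
  ∀ (f : ℕ → Ω → ℝ) (g : Ω → ℝ) (M : ℝ), (∀ n, f n ∈ C) → (∀ n, ∀ᵐ ω ∂P, |f n ω| ≤ M) →
    AEStronglyMeasurable g P → (∀ᵐ ω ∂P, Tendsto (fun n => f n ω) atTop (𝓝 (g ω))) → g ∈ C

theorem FatouClosed.congr {P : Measure Ω} {C : Set (Ω → ℝ)} (hC : FatouClosed P C) {f g : Ω → ℝ}
    (hf : f ∈ C) {M : ℝ} (hM : ∀ᵐ ω ∂P, |f ω| ≤ M) (hfm : AEStronglyMeasurable f P)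
    (h : f =ᵐ[P] g) : g ∈ C :=
  hC (fun _ => f) g M (fun _ => hf) (fun _ => hM) (hfm.congr h)
    (h.mono fun ω hω => by simp [hω])

/-- A decreasing sequence of nonempty convex Fatou closed sets of uniformly bounded functions has
a common point. -/
theorem exists_mem_of_antitone_fatouClosed {P : Measure Ω} [IsProbabilityMeasure P]
    (C : ℕ → Set (Ω → ℝ)) (hanti : Antitone C) (hconv : ∀ n, Convex ℝ (C n))
    (hclosed : ∀ n, FatouClosed P (C n)) (hne : ∀ n, (C n).Nonempty) (M : ℝ)
    (hM : ∀ f ∈ C 0, AEStronglyMeasurable f P ∧ ∀ᵐ ω ∂P, |f ω| ≤ M) : ∃ f, ∀ n, f ∈ C n := by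
  have hM' : ∀ n, ∀ f ∈ C n, AEStronglyMeasurable f P ∧ ∀ᵐ ω ∂P, |f ω| ≤ M :=
    fun n f hf => hM f (hanti (Nat.zero_le n) hf)
  have congr' : ∀ n f g, f ∈ C n → f =ᵐ[P] g → g ∈ C n := fun n f g hf h =>
    (hclosed n).congr hf (hM' n f hf).2 (hM' n f hf).1 h
  -- Uniformly bounded functions lie in L², and an L² limit is an almost sure limit along a
  -- subsequence, so Fatou closed sets become closed in a Hilbert space.
  let S : ℕ → Set (Lp ℝ 2 P) := fun n => {W | ⇑W ∈ C n}
  suffices h : ∃ W, ∀ n, W ∈ S n from let ⟨W, hW⟩ := h; ⟨W, hW⟩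
  refine exists_mem_of_antitone_convex S (fun m n hmn W hW => hanti hmn hW) ?_ ?_ ?_ M ?_
  · intro n V hV W hW a b ha hb hab
    refine congr' n _ _ (hconv n hV hW ha hb hab) ?_
    filter_upwards [Lp.coeFn_add (a • V) (b • W), Lp.coeFn_smul a V, Lp.coeFn_smul b W]
      with ω h1 h2 h3
    rw [Pi.add_apply, ← h2, ← h3, h1, Pi.add_apply]
  · intro n
    refine IsSeqClosed.isClosed fun V W hV hVW => ?_
    obtain ⟨ns, hns, hae⟩ := (tendstoInMeasure_of_tendsto_Lp hVW).exists_seq_tendsto_ae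
    exact hclosed n (fun k => V (ns k)) W M (fun k => hV _)
      (fun k => (hM' n _ (hV (ns k))).2) (Lp.aestronglyMeasurable W) hae
  · intro n
    obtain ⟨f, hf⟩ := hne n
    obtain ⟨h1, h2⟩ := hM' n f hf
    have hL : MemLp f 2 P := MemLp.of_bound h1 M h2
    exact ⟨hL.toLp f, congr' n _ _ hf hL.coeFn_toLp.symm⟩
  · intro W hW
    have hM0 : 0 ≤ M := by
      obtain ⟨ω, hω⟩ := (hM _ hW).2.exists
      exact (abs_nonneg _).trans hω
    have := Lp.norm_le_of_ae_bound (f := W) hM0 (hM _ hW).2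
    simpa [measureUnivNNReal] using this

/-- Bounded dominated convergence of expected excesses over a level. -/
theorem tendsto_integral_excess {P : Measure Ω} [IsProbabilityMeasure P] (c M : ℝ)
    (f : ℕ → Ω → ℝ) (g : Ω → ℝ) (hf : ∀ n, AEStronglyMeasurable (f n) P)
    (hM : ∀ n, ∀ᵐ ω ∂P, |f n ω| ≤ M)
    (hlim : ∀ᵐ ω ∂P, Tendsto (fun n => f n ω) atTop (𝓝 (g ω))) :
    Tendsto (fun n => ∫ ω, max (f n ω - c) 0 ∂P) atTop (𝓝 (∫ ω, max (g ω - c) 0 ∂P)) := by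
  refine tendsto_integral_of_dominated_convergence (fun _ => M + |c|) (fun n => ?_)
    (integrable_const _) (fun n => ?_) ?_
  · exact ((hf n).sub aestronglyMeasurable_const).sup aestronglyMeasurable_const
  · filter_upwards [hM n] with ω hω
    rw [Real.norm_eq_abs, abs_of_nonneg (le_max_right _ _)]
    have h1 := abs_le.1 hω
    have h2 := neg_abs_le c
    have h3 := abs_nonneg (f n ω)
    have h4 := abs_nonneg c
    exact max_le (by linarith) (by linarith)
  · filter_upwards [hlim] with ω hω
    exact (hω.sub_const c).max tendsto_const_nhds

/-! ### Expected excesses and the choice of levels -/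

/-- The set of members of `C` whose expected excess over `c` is at most `e`. -/
def excessSet (P : Measure Ω) (C : Set (Ω → ℝ)) (c e : ℝ) : Set (Ω → ℝ) :=
  {f | f ∈ C ∧ ∫ ω, max (f ω - c) 0 ∂P ≤ e}

/-- Members of `C` that are almost surely at most `d`. -/
def boundedSet (P : Measure Ω) (C : Set (Ω → ℝ)) (d : ℝ) : Set (Ω → ℝ) :=
  {f | f ∈ C ∧ ∀ᵐ ω ∂P, f ω ≤ d}

/-- Convex Fatou closed sets of nonnegative bounded functions. -/
structure IsAdmissible (P : Measure Ω) (C : Set (Ω → ℝ)) : Prop where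
  memLp : ∀ f ∈ C, MemLp f ∞ P
  nonneg : ∀ f ∈ C, ∀ᵐ ω ∂P, 0 ≤ f ω
  convex : Convex ℝ C
  closed : FatouClosed P C

theorem integrable_excess {P : Measure Ω} [IsProbabilityMeasure P] {f : Ω → ℝ}
    (hf : MemLp f ∞ P) (c : ℝ) : Integrable (fun ω => max (f ω - c) 0) P :=
  (((hf.integrable le_top).sub (integrable_const c)).sup (integrable_const 0))

theorem IsAdmissible.excess {P : Measure Ω} [IsProbabilityMeasure P] {C : Set (Ω → ℝ)}
    (hC : IsAdmissible P C) (c e : ℝ) : IsAdmissible P (excessSet P C c e) where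
  memLp f hf := hC.memLp f hf.1
  nonneg f hf := hC.nonneg f hf.1
  convex := by
    intro f hf g hg a b ha hb hab
    refine ⟨hC.convex hf.1 hg.1 ha hb hab, ?_⟩
    have hfi := integrable_excess (hC.memLp f hf.1) c
    have hgi := integrable_excess (hC.memLp g hg.1) c
    calc ∫ ω, max ((a • f + b • g) ω - c) 0 ∂P
        ≤ ∫ ω, a * max (f ω - c) 0 + b * max (g ω - c) 0 ∂P := by
          refine integral_mono (integrable_excess
            (hC.memLp _ (hC.convex hf.1 hg.1 ha hb hab)) c)
            ((hfi.const_mul a).add (hgi.const_mul b)) fun ω => ?_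
          have h1 := mul_le_mul_of_nonneg_left (le_max_left (f ω - c) 0) ha
          have h2 := mul_le_mul_of_nonneg_left (le_max_left (g ω - c) 0) hb
          have h3 := mul_nonneg ha (le_max_right (f ω - c) 0)
          have h4 := mul_nonneg hb (le_max_right (g ω - c) 0)
          refine max_le ?_ (by linarith)
          have : c = a * c + b * c := by rw [← add_mul, hab, one_mul]
          simp only [Pi.add_apply, Pi.smul_apply, smul_eq_mul]
          nlinarith
      _ = a * ∫ ω, max (f ω - c) 0 ∂P + b * ∫ ω, max (g ω - c) 0 ∂P := by
          rw [integral_add (hfi.const_mul a) (hgi.const_mul b), integral_const_mul,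
            integral_const_mul]
      _ ≤ a * e + b * e := add_le_add (mul_le_mul_of_nonneg_left hf.2 ha)
          (mul_le_mul_of_nonneg_left hg.2 hb)
      _ = e := by rw [← add_mul, hab, one_mul]
  closed f g M hf hM hg hlim :=
    ⟨hC.closed f g M (fun n => (hf n).1) hM hg hlim,
      le_of_tendsto' (tendsto_integral_excess c M f g
        (fun n => (hC.memLp _ (hf n).1).1) hM hlim) fun n => (hf n).2⟩

theorem IsAdmissible.bounded {P : Measure Ω} {C : Set (Ω → ℝ)}
    (hC : IsAdmissible P C) (d : ℝ) : IsAdmissible P (boundedSet P C d) where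
  memLp f hf := hC.memLp f hf.1
  nonneg f hf := hC.nonneg f hf.1
  convex := by
    intro f hf g hg a b ha hb hab
    refine ⟨hC.convex hf.1 hg.1 ha hb hab, ?_⟩
    filter_upwards [hf.2, hg.2] with ω h1 h2
    have h3 := mul_le_mul_of_nonneg_left h1 ha
    have h4 := mul_le_mul_of_nonneg_left h2 hb
    have : d = a * d + b * d := by rw [← add_mul, hab, one_mul]
    simp only [Pi.add_apply, Pi.smul_apply, smul_eq_mul]
    linarith
  closed f g M hf hM hg hlim := by
    refine ⟨hC.closed f g M (fun n => (hf n).1) hM hg hlim, ?_⟩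
    filter_upwards [hlim, ae_all_iff.2 fun n => (hf n).2] with ω h1 h2
    exact le_of_tendsto' h1 h2

/-- If no member of `C` is bounded by `c`, then no member of `C` bounded by `c + 1` has a small
expected excess over `c`. -/
theorem IsAdmissible.exists_excess {P : Measure Ω} [IsProbabilityMeasure P] {C : Set (Ω → ℝ)}
    (hC : IsAdmissible P C) {c : ℝ} (hc : boundedSet P C c = ∅) :
    ∃ e : ℝ, 0 < e ∧ boundedSet P (excessSet P C c e) (c + 1) = ∅ := by
  by_contra! hcon
  -- The cap c + 1 supplies the uniform bound that compactness needs. A common point has zero excess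
  -- over c, hence is bounded by c.
  obtain ⟨f, hf⟩ := exists_mem_of_antitone_fatouClosed (P := P)
    (fun n : ℕ => boundedSet P (excessSet P C c (1 / ((n : ℝ) + 1))) (c + 1))
    (fun m n hmn f hf => ⟨⟨hf.1.1, hf.1.2.trans (Nat.one_div_le_one_div hmn)⟩, hf.2⟩)
    (fun n => ((hC.excess _ _).bounded _).convex)
    (fun n => ((hC.excess _ _).bounded _).closed)
    (fun n => hcon _ (by positivity)) (c + 1) (fun f hf => ⟨(hC.memLp f hf.1.1).1, by
      filter_upwards [hf.2, hC.nonneg f hf.1.1] with ω h1 h2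
      rwa [abs_of_nonneg h2]⟩)
  have hfC : f ∈ C := (hf 0).1.1
  have h0 : ∫ ω, max (f ω - c) 0 ∂P ≤ 0 :=
    ge_of_tendsto' tendsto_one_div_add_atTop_nhds_zero_nat fun n => (hf n).1.2
  have h1 := (integral_eq_zero_iff_of_nonneg (fun ω => le_max_right (f ω - c) 0)
    (integrable_excess (hC.memLp f hfC) c)).1
      (le_antisymm h0 (integral_nonneg fun ω => le_max_right _ _))
  have : f ∈ boundedSet P C c := ⟨hfC, by
    filter_upwards [h1] with ω hω
    have h2 := le_max_left (f ω - c) 0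
    have h3 : max (f ω - c) 0 = 0 := hω
    linarith⟩
  rw [hc] at this
  exact this

/-- If no member of `C` is bounded by `1`, then there are levels `e n > 0` such that every member
of `C` exceeds one of them. -/
theorem IsAdmissible.exists_levels {P : Measure Ω} [IsProbabilityMeasure P] {C : Set (Ω → ℝ)}
    (hC : IsAdmissible P C) (hc : boundedSet P C 1 = ∅) :
    ∃ e : ℕ → ℝ, (∀ n, 0 < e n) ∧
      ∀ f ∈ C, ¬ ∀ n : ℕ, ∫ ω, max (f ω - (n + 1)) 0 ∂P ≤ e n := by
  -- State of the recursion: the stage n and the part of `C` obeying the first n bounds, with the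
  -- invariant that none of its members is bounded by n + 1. A function obeying all bounds would
  -- break the invariant at any n above its essential supremum.
  let T : Type _ := {p : ℕ × Set (Ω → ℝ) //
    IsAdmissible P p.2 ∧ boundedSet P p.2 ((p.1 : ℝ) + 1) = ∅}
  have hstep : ∀ p : T, ∃ e : ℝ, 0 < e ∧
      boundedSet P (excessSet P p.1.2 ((p.1.1 : ℝ) + 1) e) ((p.1.1 : ℝ) + 1 + 1) = ∅ :=
    fun p => p.2.1.exists_excess p.2.2
  choose e he0 he using hstep
  let next : T → T := fun p => ⟨(p.1.1 + 1, excessSet P p.1.2 ((p.1.1 : ℝ) + 1) (e p)),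
    p.2.1.excess _ _, by simpa using he p⟩
  let x : ℕ → T := fun n => next^[n] ⟨(0, C), hC, by simpa using hc⟩
  have hx : ∀ n, x (n + 1) = next (x n) := fun n => Function.iterate_succ_apply' _ _ _
  have hx1 : ∀ n, (x n).1.1 = n := by
    intro n
    induction n with
    | zero => rfl
    | succ n ih => rw [hx]; simp [next, ih]
  refine ⟨fun n => e (x n), fun n => he0 _, fun f hf hall => ?_⟩
  have hmem : ∀ n, f ∈ (x n).1.2 := by
    intro n
    induction n with
    | zero => exact hf
    | succ n ih =>
      rw [hx]
      refine ⟨ih, ?_⟩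
      rw [hx1]
      exact hall n
  obtain ⟨M, hM⟩ := exists_ae_abs_le (hC.memLp f hf)
  obtain ⟨n, hn⟩ := exists_nat_ge M
  have h3 : f ∈ boundedSet P (x n).1.2 (((x n).1.1 : ℝ) + 1) := by
    refine ⟨hmem n, ?_⟩
    filter_upwards [hM] with ω h4
    rw [hx1]
    linarith [le_abs_self (f ω)]
  rw [(x n).2.2] at h3
  exact h3

/-! ### From functionals on L^∞ to measures -/

/-- A bounded function is uniformly approximated by simple functions. -/
theorem exists_simpleFunc_near {f : Ω → ℝ} (hf : Measurable f) {M : ℝ} (hM : ∀ ω, |f ω| ≤ M)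
    {ε : ℝ} (hε : 0 < ε) : ∃ s : SimpleFunc Ω ℝ, ∀ ω, |f ω - s ω| ≤ ε := by
  have hfl : Measurable fun ω => ⌊f ω / ε⌋ := Int.measurable_floor.comp (hf.div_const ε)
  have hfin : (range fun ω => ⌊f ω / ε⌋).Finite := by
    refine (finite_Icc (⌊-M / ε⌋) (⌊M / ε⌋)).subset ?_
    rintro _ ⟨ω, rfl⟩
    have h := abs_le.1 (hM ω)
    exact ⟨Int.floor_mono (by gcongr; exact h.1), Int.floor_mono (by gcongr; exact h.2)⟩
  let k : SimpleFunc Ω ℤ := ⟨fun ω => ⌊f ω / ε⌋, fun z => hfl (measurableSet_singleton z), hfin⟩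
  refine ⟨k.map fun z : ℤ => ε * (z : ℝ), fun ω => ?_⟩
  have h1 : (k.map fun z : ℤ => ε * (z : ℝ)) ω = ε * (⌊f ω / ε⌋ : ℝ) := rfl
  have h2 := Int.floor_le (f ω / ε)
  have h3 := (Int.lt_floor_add_one (f ω / ε)).le
  have h4 : f ω = ε * (f ω / ε) := by field_simp
  have h5 := mul_le_mul_of_nonneg_left h2 hε.le
  have h6 := mul_le_mul_of_nonneg_left h3 hε.le
  rw [h1, abs_le]
  constructor <;> linarith

/-- A positive functional on `L^∞` that is small on indicators of small sets is integration
against a finite measure. -/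
theorem exists_measure_of_functional {P : Measure Ω} [IsProbabilityMeasure P]
    (l : Lp ℝ ∞ P →L[ℝ] ℝ) (hpos : ∀ V : Lp ℝ ∞ P, (∀ᵐ ω ∂P, 0 ≤ V ω) → 0 ≤ l V)
    (hsmall : ∀ ε : ℝ, 0 < ε → ∃ δ : ℝ≥0∞, 0 < δ ∧ ∀ (B : Set Ω) (hB : MeasurableSet B),
      P B ≤ δ → l (indicatorConstLp ∞ hB (measure_ne_top P B) 1) ≤ ε) :
    ∃ μ : Measure Ω, IsFiniteMeasure μ ∧ μ ≪ P ∧ ∀ V : Lp ℝ ∞ P, ∫ ω, V ω ∂μ = l V := by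
  let I : ∀ B : Set Ω, MeasurableSet B → ℝ :=
    fun B hB => l (indicatorConstLp ∞ hB (measure_ne_top P B) 1)
  have hI0 : ∀ B hB, 0 ≤ I B hB := fun B hB => hpos _ (by
    filter_upwards [indicatorConstLp_coeFn (p := ∞) (hs := hB) (hμs := measure_ne_top P B)
      (c := (1 : ℝ))] with ω hω
    rw [hω]
    exact indicator_nonneg (fun _ _ => zero_le_one) _)
  have hIadd : ∀ s t (hs : MeasurableSet s) (ht : MeasurableSet t), Disjoint s t →
      I (s ∪ t) (hs.union ht) = I s hs + I t ht := fun s t hs ht hst => by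
    simp only [I]
    rw [indicatorConstLp_disjoint_union hs ht (measure_ne_top P s) (measure_ne_top P t) hst,
      map_add]
  have hIempty : I ∅ MeasurableSet.empty = 0 := by simp [I, indicatorConstLp_empty]
  have hIcongr : ∀ s t (hs : MeasurableSet s) (ht : MeasurableSet t), s = t → I s hs = I t ht := by
    rintro s t hs ht rfl; rfl
  have hIsum : ∀ f : ℕ → Set Ω, ∀ hf : (∀ i, MeasurableSet (f i)), Pairwise (Function.onFun Disjoint f) →
      HasSum (fun i => I (f i) (hf i)) (I (⋃ i, f i) (MeasurableSet.iUnion hf)) := by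
    intro f hf hdisj
    -- Tails of the union: they decrease to the empty set, so their probability, and by `hsmall` the
    -- value of `I` on them, tends to 0. Finite additivity then becomes countable additivity.
    let R : ℕ → Set Ω := fun n => ⋃ i ∈ Ici n, f i
    have hR : ∀ n, MeasurableSet (R n) := fun n =>
      MeasurableSet.biUnion (to_countable _) fun i _ => hf i
    have hRsucc : ∀ n, R n = f n ∪ R (n + 1) := by
      intro n
      ext ω
      simp only [R, mem_iUnion, mem_Ici, mem_union]
      constructor
      · rintro ⟨i, hi, hω⟩
        rcases hi.eq_or_lt with rfl | h
        · exact Or.inl hω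
        · exact Or.inr ⟨i, h, hω⟩
      · rintro (hω | ⟨i, hi, hω⟩)
        · exact ⟨n, le_rfl, hω⟩
        · exact ⟨i, by omega, hω⟩
    have hRdisj : ∀ n, Disjoint (f n) (R (n + 1)) := fun n => by
      simp only [R, disjoint_iUnion_right]
      intro i hi
      exact hdisj (by have : n + 1 ≤ i := hi; omega)
    have hsumR : ∀ n, I (⋃ i, f i) (MeasurableSet.iUnion hf)
        = ∑ i ∈ Finset.range n, I (f i) (hf i) + I (R n) (hR n) := by
      intro n
      induction n with
      | zero => simpa using hIcongr _ _ _ _ (by simp [R])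
      | succ n ih =>
        rw [ih, Finset.sum_range_succ, add_assoc, ← hIadd _ _ _ _ (hRdisj n)]
        exact congrArg _ (hIcongr _ _ _ _ (hRsucc n))
    have hRanti : Antitone R := fun m n hmn =>
      biUnion_subset_biUnion_left (Ici_subset_Ici.2 hmn)
    have hRinter : ⋂ n, R n = ∅ := by
      refine eq_empty_of_forall_notMem fun ω hω => ?_
      simp only [R, mem_iInter, mem_iUnion, mem_Ici] at hω
      obtain ⟨i, -, hi⟩ := hω 0
      obtain ⟨j, hj, hj'⟩ := hω (i + 1)
      exact disjoint_left.1 (hdisj (show i ≠ j by omega)) hi hj'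
    have hPR : Tendsto (fun n => P (R n)) atTop (𝓝 0) := by
      have := tendsto_measure_iInter_atTop (μ := P) (fun n => (hR n).nullMeasurableSet) hRanti
        ⟨0, measure_ne_top _ _⟩
      rwa [hRinter, measure_empty] at this
    have hIR : Tendsto (fun n => I (R n) (hR n)) atTop (𝓝 0) := by
      rw [Metric.tendsto_atTop]
      intro ε hε
      obtain ⟨δ, hδ, hδ'⟩ := hsmall (ε / 2) (by positivity)
      obtain ⟨N, hN⟩ := eventually_atTop.1 (hPR.eventually (eventually_le_nhds hδ))
      refine ⟨N, fun n hn => ?_⟩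
      rw [Real.dist_0_eq_abs, abs_of_nonneg (hI0 _ _)]
      exact (hδ' _ (hR n) (hN n hn)).trans_lt (by linarith)
    rw [hasSum_iff_tendsto_nat_of_nonneg (fun i => hI0 _ _)]
    have : (fun n => ∑ i ∈ Finset.range n, I (f i) (hf i)) =
        fun n => I (⋃ i, f i) (MeasurableSet.iUnion hf) - I (R n) (hR n) := by
      ext n
      rw [hsumR n, add_sub_cancel_right]
    rw [this]
    simpa using hIR.const_sub (I (⋃ i, f i) (MeasurableSet.iUnion hf))
  let μ : Measure Ω := Measure.ofMeasurable (fun B hB => ENNReal.ofReal (I B hB))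
    (by simp [hIempty]) (fun f hf hdisj => by
      have := hIsum f hf hdisj
      rw [← this.tsum_eq, ENNReal.ofReal_tsum_of_nonneg (fun i => hI0 _ _) this.summable])
  have hμ : ∀ B (hB : MeasurableSet B), μ B = ENNReal.ofReal (I B hB) := fun B hB =>
    Measure.ofMeasurable_apply B hB
  have hfinite : IsFiniteMeasure μ := ⟨by rw [hμ _ MeasurableSet.univ]; exact ENNReal.ofReal_lt_top⟩
  have hac : μ ≪ P := by
    refine Measure.AbsolutelyContinuous.mk fun B hB h0 => ?_
    have : indicatorConstLp ∞ hB (measure_ne_top P B) (1 : ℝ) = 0 := by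
      ext1
      filter_upwards [indicatorConstLp_coeFn (p := ∞) (hs := hB) (hμs := measure_ne_top P B)
        (c := (1 : ℝ)), Lp.coeFn_zero ℝ ∞ P, measure_eq_zero_iff_ae_notMem.1 h0] with ω h1 h2 h3
      rw [h1, h2, indicator_of_notMem h3]
      rfl
    rw [hμ B hB]
    simp [I, this]
  refine ⟨μ, hfinite, hac, fun V => ?_⟩
  have hsimple : ∀ s : SimpleFunc Ω ℝ, ∫ ω, s ω ∂μ = l ((s.memLp_top P).toLp s) := by
    intro s
    induction s using SimpleFunc.induction with
    | const c hs =>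
      rename_i s
      have h1 : ⇑(SimpleFunc.piecewise s hs (SimpleFunc.const Ω c) (SimpleFunc.const Ω 0))
          = s.indicator fun _ => c := by
        ext ω
        simp [SimpleFunc.coe_piecewise, Set.piecewise, indicator]
      have h2 : ((SimpleFunc.memLp_top (SimpleFunc.piecewise s hs (SimpleFunc.const Ω c)
          (SimpleFunc.const Ω 0)) P).toLp _) =
          c • indicatorConstLp ∞ hs (measure_ne_top P s) (1 : ℝ) := by
        ext1
        filter_upwards [MemLp.coeFn_toLp (SimpleFunc.memLp_top (SimpleFunc.piecewise s hs
          (SimpleFunc.const Ω c) (SimpleFunc.const Ω 0)) P),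
          Lp.coeFn_smul c (indicatorConstLp ∞ hs (measure_ne_top P s) (1 : ℝ)),
          indicatorConstLp_coeFn (p := ∞) (hs := hs) (hμs := measure_ne_top P s)
            (c := (1 : ℝ))] with ω e1 e2 e3
        rw [e1, e2, h1, Pi.smul_apply, e3]
        by_cases h : ω ∈ s <;> simp [h]
      rw [h2, h1, integral_indicator_const _ hs, map_smul, smul_eq_mul, smul_eq_mul, mul_comm]
      congr 1
      rw [Measure.real, hμ s hs, ENNReal.toReal_ofReal (hI0 _ _)]
    | @add f g hfg hf hg =>
      have h1 : ((SimpleFunc.memLp_top (f + g) P).toLp _) =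
          (f.memLp_top P).toLp f + (g.memLp_top P).toLp g := rfl
      rw [h1, map_add, ← hf, ← hg]
      exact integral_add f.integrable_of_isFiniteMeasure g.integrable_of_isFiniteMeasure
  obtain ⟨M, hM⟩ := exists_ae_abs_le (Lp.memLp V)
  have hM0 : 0 ≤ M := by
    obtain ⟨ω, hω⟩ := hM.exists
    exact (abs_nonneg _).trans hω
  have hVm : Measurable V := (Lp.stronglyMeasurable V).measurable
  -- Truncation makes V bounded everywhere, as uniform approximation by simple functions requires.
  have hae : ∀ᵐ ω ∂P, V ω = max (-M) (min M (V ω)) := by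
    filter_upwards [hM] with ω hω
    rw [min_eq_right (abs_le.1 hω).2, max_eq_right (abs_le.1 hω).1]
  have hVi : Integrable V μ := by
    refine Integrable.of_bound hVm.aestronglyMeasurable M ?_
    exact hac.ae_le hM
  have hbound : ∀ ε : ℝ, 0 < ε → |∫ ω, V ω ∂μ - l V| ≤ ε * (μ.real univ + ‖l‖) := by
    intro ε hε
    obtain ⟨s, hs⟩ := exists_simpleFunc_near (f := fun ω => max (-M) (min M (V ω)))
      (measurable_const.max (measurable_const.min hVm)) (M := M)
      (fun ω => abs_le.2 ⟨le_max_left _ _, max_le (by linarith) (min_le_left _ _)⟩) hε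
    have hs' : ∀ᵐ ω ∂P, |V ω - s ω| ≤ ε := by
      filter_upwards [hae] with ω hω
      have := hs ω
      rwa [← hω] at this
    have h1 : |∫ ω, V ω ∂μ - ∫ ω, s ω ∂μ| ≤ ε * μ.real univ := by
      rw [← integral_sub hVi s.integrable_of_isFiniteMeasure]
      have := norm_integral_le_of_norm_le_const (μ := μ) (f := fun ω => V ω - s ω) (C := ε)
        (hac.ae_le hs')
      exact this
    have h2 : |l V - l ((s.memLp_top P).toLp s)| ≤ ‖l‖ * ε := by
      rw [← map_sub]
      refine (l.le_opNorm _).trans (mul_le_mul_of_nonneg_left ?_ (norm_nonneg _))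
      have := Lp.norm_le_of_ae_bound (f := V - (s.memLp_top P).toLp s) hε.le (by
        filter_upwards [hs', Lp.coeFn_sub V ((s.memLp_top P).toLp s),
          (s.memLp_top P).coeFn_toLp] with ω e1 e2 e3
        rwa [e2, Pi.sub_apply, e3])
      simpa using this
    rw [hsimple] at h1
    have h3 := abs_sub_le (∫ ω, V ω ∂μ) (l ((s.memLp_top P).toLp s)) (l V)
    rw [abs_sub_comm (l ((s.memLp_top P).toLp s)) (l V)] at h3
    linarith
  by_contra hne
  have hpos' : 0 < |∫ ω, V ω ∂μ - l V| := abs_pos.2 (sub_ne_zero.2 hne)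
  have hB : 0 < μ.real univ + ‖l‖ + 1 := by positivity
  -- This accuracy makes the bound less than half of the supposed discrepancy.
  have h1 := hbound (|∫ ω, V ω ∂μ - l V| / (2 * (μ.real univ + ‖l‖ + 1))) (by positivity)
  have h2 : |∫ ω, V ω ∂μ - l V| / (2 * (μ.real univ + ‖l‖ + 1)) * (μ.real univ + ‖l‖)
      ≤ |∫ ω, V ω ∂μ - l V| / 2 := by
    rw [div_mul_eq_mul_div, div_le_div_iff₀ (by positivity) (by norm_num)]
    nlinarith
  linarith

/-! ### Separation by a probability measure -/

theorem memLp_top_of_tendsto {P : Measure Ω} {f : ℕ → Ω → ℝ} {g : Ω → ℝ} {M : ℝ}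
    (hM : ∀ n, ∀ᵐ ω ∂P, |f n ω| ≤ M) (hg : AEStronglyMeasurable g P)
    (hlim : ∀ᵐ ω ∂P, Tendsto (fun n => f n ω) atTop (𝓝 (g ω))) : MemLp g ∞ P := by
  refine memLp_top_of_bound hg M ?_
  filter_upwards [ae_all_iff.2 hM, hlim] with ω h1 h2
  exact le_of_tendsto' h2.abs h1

theorem isAdmissible_nonneg (P : Measure Ω) :
    IsAdmissible P {f : Ω → ℝ | MemLp f ∞ P ∧ ∀ᵐ ω ∂P, 0 ≤ f ω} where
  memLp f hf := hf.1
  nonneg f hf := hf.2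
  convex := by
    intro f hf g hg a b ha hb hab
    refine ⟨(hf.1.const_smul a).add (hg.1.const_smul b), ?_⟩
    filter_upwards [hf.2, hg.2] with ω h1 h2
    exact add_nonneg (mul_nonneg ha h1) (mul_nonneg hb h2)
  closed f g M hf hM hg hlim := by
    refine ⟨memLp_top_of_tendsto hM hg hlim, ?_⟩
    filter_upwards [hlim, ae_all_iff.2 fun n => (hf n).2] with ω h1 h2
    exact ge_of_tendsto' h1 h2

/-- A convex, solid downwards, Fatou closed subset of `L^∞` that does not contain `-1` is strictly
separated from `0` by a probability measure absolutely continuous with respect to `P`. -/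
theorem exists_dualMeasure_neg {P : Measure Ω} [IsProbabilityMeasure P] {A : Set (Ω → ℝ)}
    (hne : A.Nonempty) (hmem : ∀ f ∈ A, MemLp f ∞ P) (hconv : Convex ℝ A)
    (hdown : ∀ f ∈ A, ∀ g, MemLp g ∞ P → (∀ᵐ ω ∂P, g ω ≤ f ω) → g ∈ A)
    (hclosed : FatouClosed P A) (hneg : (fun _ => -1) ∉ A) :
    ∃ Q : DualMeasure P, ∀ f ∈ A, ∫ ω, f ω ∂Q.1 < 0 := by
  let N : Set (Ω → ℝ) := {f | MemLp f ∞ P ∧ ∀ᵐ ω ∂P, 0 ≤ f ω}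
  have hN : IsAdmissible P N := isAdmissible_nonneg P
  have hC : IsAdmissible P (N ∩ {f | -f ∈ A}) :=
    { memLp := fun f hf => hf.1.1
      nonneg := fun f hf => hf.1.2
      convex := hN.convex.inter ((hconv.linear_preimage (-LinearMap.id : (Ω → ℝ) →ₗ[ℝ] (Ω → ℝ))))
      closed := fun f g M hf hM hg hlim => ⟨hN.closed f g M (fun n => (hf n).1) hM hg hlim,
        hclosed (fun n => -f n) (-g) M (fun n => (hf n).2)
          (fun n => by simpa only [Pi.neg_apply, abs_neg] using hM n) hg.neg
          (hlim.mono fun ω hω => hω.neg)⟩ }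
  obtain ⟨e, he, heC⟩ := hC.exists_levels (by
    refine eq_empty_of_forall_notMem fun f hf => hneg ?_
    refine hdown _ hf.1.2 _ (memLp_const _) ?_
    filter_upwards [hf.2] with ω hω
    exact neg_le_neg hω)
  -- By the choice of e, no -W with W in K lies in A. K replaces the constant 1 as the object to be
  -- separated from -A.
  let K : Set (Ω → ℝ) := ⋂ n : ℕ, excessSet P N ((n : ℝ) + 1) (e n)
  have hKconv : Convex ℝ K := convex_iInter fun n => (hN.excess _ _).convex
  have hKN : ∀ W ∈ K, W ∈ N := fun W hW => (mem_iInter.1 hW 0).1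
  have hKA : ∀ W ∈ K, -W ∉ A := fun W hW hA =>
    heC W ⟨hKN W hW, hA⟩ fun n => (mem_iInter.1 hW n).2
  have hK1 : (fun _ => (1 : ℝ)) ∈ K := by
    refine mem_iInter.2 fun n => ⟨⟨memLp_const _, ae_of_all _ fun _ => zero_le_one⟩, ?_⟩
    simp [(he n).le]
  -- The upward hull of -K with a strict margin ε: the margin makes it open in norm, and solidity of
  -- A keeps it disjoint from A.
  let O : Set (Lp ℝ ∞ P) := {V | ∃ W ∈ K, ∃ ε : ℝ, 0 < ε ∧ ∀ᵐ ω ∂P, -W ω + ε ≤ V ω}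
  have hOconv : Convex ℝ O := by
    rintro V ⟨W, hW, ε, hε, h⟩ V' ⟨W', hW', ε', hε', h'⟩ a b ha hb hab
    refine ⟨a • W + b • W', hKconv hW hW' ha hb hab, a * ε + b * ε', ?_, ?_⟩
    · rcases ha.eq_or_lt with rfl | ha'
      · rw [zero_add] at hab
        simpa [hab] using hε'
      · positivity
    · filter_upwards [h, h', Lp.coeFn_add (a • V) (b • V'), Lp.coeFn_smul a V,
        Lp.coeFn_smul b V'] with ω h1 h2 e1 e2 e3
      have e : (a • V + b • V' : Lp ℝ ∞ P) ω = a * V ω + b * V' ω := by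
        rw [e1, Pi.add_apply, e2, e3]; rfl
      rw [e]
      have h3 := mul_le_mul_of_nonneg_left h1 ha
      have h4 := mul_le_mul_of_nonneg_left h2 hb
      simp only [Pi.add_apply, Pi.smul_apply, smul_eq_mul]
      linarith
  have hOopen : IsOpen O := by
    rw [Metric.isOpen_iff]
    rintro V ⟨W, hW, ε, hε, h⟩
    refine ⟨ε / 2, by positivity, fun V' hV' => ⟨W, hW, ε / 2, by positivity, ?_⟩⟩
    rw [mem_ball_iff_norm] at hV'
    have hfin : eLpNormEssSup (V' - V : Lp ℝ ∞ P) P ≠ ∞ := by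
      have := (Lp.memLp (V' - V)).2
      rw [eLpNorm_exponent_top] at this
      exact this.ne
    rw [Lp.norm_def, eLpNorm_exponent_top] at hV'
    filter_upwards [h, Lp.coeFn_sub V' V,
      ae_le_eLpNormEssSup (f := (V' - V : Lp ℝ ∞ P)) (μ := P)] with ω h1 h2 h3
    have h4 := ENNReal.toReal_mono hfin h3
    rw [toReal_enorm, Real.norm_eq_abs, h2, Pi.sub_apply] at h4
    have := neg_abs_le (V' ω - V ω)
    linarith
  let T : Set (Lp ℝ ∞ P) := {V | ⇑V ∈ A}
  have hcongr : ∀ f ∈ A, ∀ g, f =ᵐ[P] g → g ∈ A := fun f hf g h =>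
    hdown f hf g ((memLp_congr_ae h).1 (hmem f hf)) h.symm.le
  have hTconv : Convex ℝ T := by
    intro V hV V' hV' a b ha hb hab
    refine hcongr _ (hconv hV hV' ha hb hab) _ ?_
    filter_upwards [Lp.coeFn_add (a • V) (b • V'), Lp.coeFn_smul a V,
      Lp.coeFn_smul b V'] with ω e1 e2 e3
    rw [Pi.add_apply, ← e2, ← e3, e1, Pi.add_apply]
  have hdisj : Disjoint O T := by
    rw [Set.disjoint_left]
    rintro V ⟨W, hW, ε, hε, h⟩ hV
    refine hKA W hW (hdown _ hV _ (hKN W hW).1.neg ?_)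
    filter_upwards [h] with ω hω
    rw [Pi.neg_apply]
    linarith
  obtain ⟨l', u', hO', hT'⟩ := geometric_hahn_banach_open hOconv hOopen hTconv hdisj
  -- The sign is reversed because Hahn–Banach places the open set on the lower side.
  let l : Lp ℝ ∞ P →L[ℝ] ℝ := -l'
  let u : ℝ := -u'
  have hO : ∀ V ∈ O, u < l V := fun V hV => neg_lt_neg (hO' V hV)
  have hT : ∀ V ∈ T, l V ≤ u := fun V hV => neg_le_neg (hT' V hV)
  have hOnonneg : ∀ V : Lp ℝ ∞ P, (∀ᵐ ω ∂P, 0 ≤ V ω) → V ∈ O := fun V hV =>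
    ⟨_, hK1, 1, one_pos, by simpa using hV⟩
  have hu : u < 0 := by
    have := hO 0 (hOnonneg 0 (by
      filter_upwards [Lp.coeFn_zero ℝ ∞ P] with ω hω
      rw [hω]; rfl))
    simpa using this
  -- The nonnegative cone lies in O, where l > u. A negative value on the cone could be rescaled to
  -- equal u.
  have hlpos : ∀ V : Lp ℝ ∞ P, (∀ᵐ ω ∂P, 0 ≤ V ω) → 0 ≤ l V := by
    intro V hV
    by_contra! hlt
    have h1 := hO ((u / l V) • V) (hOnonneg _ (by
      filter_upwards [hV, Lp.coeFn_smul (u / l V) V] with ω h1 h2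
      rw [h2]
      exact mul_nonneg (div_nonneg_of_nonpos hu.le hlt.le) h1))
    rw [map_smul, smul_eq_mul, div_mul_cancel₀ _ hlt.ne] at h1
    exact lt_irrefl _ h1
  have hlK : ∀ V : Lp ℝ ∞ P, ⇑V ∈ K → l V ≤ -u := by
    intro V hV
    have h1 : ∀ ε : ℝ, 0 < ε → l V ≤ -u + ε * l (Lp.const ∞ P 1) := by
      intro ε hε
      have := hO (-V + ε • Lp.const ∞ P 1) ⟨V, hV, ε, hε, by
        filter_upwards [Lp.coeFn_add (-V) (ε • Lp.const ∞ P (1 : ℝ)), Lp.coeFn_neg V,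
          Lp.coeFn_smul ε (Lp.const ∞ P (1 : ℝ)), Lp.coeFn_const ∞ P (1 : ℝ)] with ω e1 e2 e3 e4
        rw [e1, Pi.add_apply, e2, e3, Pi.smul_apply, e4]
        simp⟩
      rw [map_add, map_neg, map_smul, smul_eq_mul] at this
      linarith
    have h2 : Tendsto (fun n : ℕ => -u + 1 / ((n : ℝ) + 1) * l (Lp.const ∞ P 1)) atTop
        (𝓝 (-u + 0 * l (Lp.const ∞ P 1))) :=
      (tendsto_one_div_add_atTop_nhds_zero_nat.mul_const _).const_add _
    have := ge_of_tendsto' h2 fun n : ℕ => h1 (1 / ((n : ℝ) + 1)) (by positivity)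
    simpa using this
  obtain ⟨μ, hμfin, hμac, hμ⟩ := exists_measure_of_functional l hlpos (by
    intro ε hε
    -- Once m·1_B lies in K, the bound m l(1_B) ≤ -u gives l(1_B) ≤ ε. Since m·1_B has no excess
    -- over n + 1 for n ≥ m, only finitely many levels restrict P B.
    obtain ⟨m, hm⟩ := exists_nat_gt (-u / ε)
    have hm0 : (0 : ℝ) < m := (div_pos (neg_pos.2 hu) hε).trans hm
    obtain ⟨δ, hδ, hδe⟩ : ∃ δ : ℝ, 0 < δ ∧ ∀ n < m, m * δ ≤ e n := by
      have : ∀ k : ℕ, ∃ δ : ℝ, 0 < δ ∧ ∀ n < k, m * δ ≤ e n := by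
        intro k
        induction k with
        | zero => exact ⟨1, one_pos, by simp⟩
        | succ k ih =>
          obtain ⟨δ, hδ, h⟩ := ih
          refine ⟨min δ (e k / m), lt_min hδ (div_pos (he k) hm0), fun n hn => ?_⟩
          rcases Nat.lt_succ_iff_lt_or_eq.1 hn with h1 | rfl
          · exact (mul_le_mul_of_nonneg_left (min_le_left _ _) hm0.le).trans (h n h1)
          · refine (mul_le_mul_of_nonneg_left (min_le_right _ _) hm0.le).trans ?_
            rw [mul_div_cancel₀ _ hm0.ne']
      exact this m
    refine ⟨ENNReal.ofReal δ, ENNReal.ofReal_pos.2 hδ, fun B hB hPB => ?_⟩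
    have hcoe : ⇑((m : ℝ) • indicatorConstLp ∞ hB (measure_ne_top P B) (1 : ℝ)) =ᵐ[P]
        B.indicator fun _ => (m : ℝ) := by
      filter_upwards [Lp.coeFn_smul (m : ℝ) (indicatorConstLp ∞ hB (measure_ne_top P B) (1 : ℝ)),
        indicatorConstLp_coeFn (p := ∞) (hs := hB) (hμs := measure_ne_top P B)
          (c := (1 : ℝ))] with ω e1 e2
      rw [e1, Pi.smul_apply, e2]
      by_cases h : ω ∈ B <;> simp [h]
    have hmK : ⇑((m : ℝ) • indicatorConstLp ∞ hB (measure_ne_top P B) (1 : ℝ)) ∈ K := by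
      refine mem_iInter.2 fun n => ⟨⟨Lp.memLp _, ?_⟩, ?_⟩
      · filter_upwards [hcoe] with ω hω
        rw [hω]
        exact indicator_nonneg (fun _ _ => hm0.le) _
      · have h1 : ∫ ω, max (((m : ℝ) • indicatorConstLp ∞ hB (measure_ne_top P B) (1 : ℝ) :
            Lp ℝ ∞ P) ω - ((n : ℝ) + 1)) 0 ∂P
            = ∫ ω, B.indicator (fun _ => max ((m : ℝ) - (n + 1)) 0) ω ∂P := by
          refine integral_congr_ae ?_
          filter_upwards [hcoe] with ω hω
          simp only [hω]
          by_cases h : ω ∈ B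
          · simp [h]
          · have : (0 : ℝ) ≤ n := n.cast_nonneg
            simp only [h, not_false_eq_true, indicator_of_notMem]
            exact max_eq_right (by linarith)
        rw [h1, integral_indicator_const _ hB, smul_eq_mul]
        by_cases hnm : n < m
        · refine le_trans ?_ (hδe n hnm)
          rw [mul_comm]
          refine mul_le_mul (max_le ?_ hm0.le) ?_ measureReal_nonneg hm0.le
          · have : (0 : ℝ) ≤ n := n.cast_nonneg
            linarith
          · exact ENNReal.toReal_le_of_le_ofReal hδ.le hPB
        · have : (m : ℝ) ≤ n := by exact_mod_cast not_lt.1 hnm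
          rw [max_eq_right (by linarith), mul_zero]
          exact (he n).le
    have h1 := hlK _ hmK
    rw [map_smul, smul_eq_mul] at h1
    have h2 : -u < m * ε := by rwa [div_lt_iff₀ hε] at hm
    exact le_of_mul_le_mul_left (h1.trans h2.le) hm0)
  have hint : ∀ f ∈ A, ∫ ω, f ω ∂μ < 0 := by
    intro f hf
    have h1 := hμ ((hmem f hf).toLp f)
    have h2 : ⇑((hmem f hf).toLp f) =ᵐ[P] f := (hmem f hf).coeFn_toLp
    rw [integral_congr_ae (hμac.ae_eq h2)] at h1
    rw [h1]
    exact (hT _ (hcongr f hf _ h2.symm)).trans_lt hu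
  have hμ0 : μ ≠ 0 := by
    rintro rfl
    obtain ⟨f, hf⟩ := hne
    simpa using hint f hf
  have hμuniv : μ univ ≠ 0 := fun h => hμ0 (Measure.measure_univ_eq_zero.1 h)
  refine ⟨⟨(μ univ)⁻¹ • μ, ⟨?_⟩, hμac.smul_left _⟩, fun f hf => ?_⟩
  · rw [Measure.smul_apply, smul_eq_mul, ENNReal.inv_mul_cancel hμuniv (measure_ne_top _ _)]
  · rw [integral_smul_measure, smul_eq_mul]
    refine mul_neg_of_pos_of_neg (ENNReal.toReal_pos ?_ ?_) (hint f hf)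
    · exact ENNReal.inv_ne_zero.2 (measure_ne_top _ _)
    · exact ENNReal.inv_ne_top.2 hμuniv

/-! ### Logarithmic coordinates and sublevel sets -/

theorem memLp_log {P : Measure Ω} (X : LinfPP P) : MemLp (fun ω => Real.log (X.1 ω)) ∞ P := by
  obtain ⟨c, C, hc, hC, h⟩ := bounds X
  refine memLp_top_of_bound (Real.measurable_log.comp
    (Lp.stronglyMeasurable X.1).measurable).aestronglyMeasurable
    (max (-Real.log c) (Real.log C)) ?_
  filter_upwards [h] with ω hω
  have h1 := Real.log_le_log hc hω.1
  have h2 := Real.log_le_log (hc.trans_le hω.1) hω.2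
  exact abs_le.2 ⟨by linarith [le_max_left (-Real.log c) (Real.log C)],
    h2.trans (le_max_right _ _)⟩

theorem memLp_exp {P : Measure Ω} {f : Ω → ℝ} (hf : MemLp f ∞ P) :
    MemLp (fun ω => Real.exp (f ω)) ∞ P := by
  obtain ⟨M, hM⟩ := exists_ae_abs_le hf
  refine memLp_top_of_bound (Real.continuous_exp.comp_aestronglyMeasurable hf.1) (Real.exp M) ?_
  filter_upwards [hM] with ω hω
  rw [Real.norm_eq_abs, abs_of_pos (Real.exp_pos _)]
  exact Real.exp_le_exp.2 (abs_le.1 hω).2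

/-- The element of `L^∞_{++}` with a given bounded logarithm. -/
noncomputable def ofLog {P : Measure Ω} (f : Ω → ℝ) (hf : MemLp f ∞ P) : LinfPP P :=
  ⟨(memLp_exp hf).toLp _, by
    obtain ⟨M, hM⟩ := exists_ae_abs_le hf
    refine ⟨Real.exp (-M), Real.exp_pos _, ?_⟩
    filter_upwards [hM, (memLp_exp hf).coeFn_toLp] with ω h1 h2
    rw [h2]
    exact Real.exp_le_exp.2 (abs_le.1 h1).1⟩

theorem coeFn_ofLog {P : Measure Ω} {f : Ω → ℝ} (hf : MemLp f ∞ P) :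
    (ofLog f hf).1 =ᵐ[P] fun ω => Real.exp (f ω) := (memLp_exp hf).coeFn_toLp

theorem pos_ae {P : Measure Ω} (X : LinfPP P) : ∀ᵐ ω ∂P, 0 < X.1 ω := by
  obtain ⟨c, hc, h⟩ := X.2
  exact h.mono fun ω hω => hc.trans_le hω

theorem log_ofLog {P : Measure Ω} {f : Ω → ℝ} (hf : MemLp f ∞ P) :
    (fun ω => Real.log ((ofLog f hf).1 ω)) =ᵐ[P] f := by
  filter_upwards [coeFn_ofLog hf] with ω hω
  rw [hω, Real.log_exp]

theorem ofLog_log {P : Measure Ω} (X : LinfPP P) :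
    (ofLog (fun ω => Real.log (X.1 ω)) (memLp_log X)).1 =ᵐ[P] X.1 := by
  filter_upwards [coeFn_ofLog (memLp_log X), pos_ae X] with ω h1 h2
  rw [h1, Real.exp_log h2]

theorem log_geomMean {P : Measure Ω} (X Y : LinfPP P) {a : ℝ} (h0 : 0 < a) (h1 : a < 1) :
    (fun ω => Real.log ((geomMean X Y a h0 h1).1 ω)) =ᵐ[P]
      fun ω => a * Real.log (X.1 ω) + (1 - a) * Real.log (Y.1 ω) := by
  filter_upwards [pos_ae X, pos_ae Y, (memLp_geom X Y h0 h1).coeFn_toLp] with ω hX hY h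
  have h' : (geomMean X Y a h0 h1).1 ω = X.1 ω ^ a * Y.1 ω ^ (1 - a) := h
  rw [h', Real.log_mul (Real.rpow_pos_of_pos hX _).ne' (Real.rpow_pos_of_pos hY _).ne',
    Real.log_rpow hX, Real.log_rpow hY]

theorem IsMonotone.ofLog_le {P : Measure Ω} {ρ : LinfPP P → ℝ≥0∞} (hρ : IsMonotone ρ)
    {f g : Ω → ℝ} (hf : MemLp f ∞ P) (hg : MemLp g ∞ P) (h : ∀ᵐ ω ∂P, f ω ≤ g ω) :
    ρ (ofLog f hf) ≤ ρ (ofLog g hg) := by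
  refine hρ _ _ ?_
  filter_upwards [h, coeFn_ofLog hf, coeFn_ofLog hg] with ω h1 h2 h3
  rw [h2, h3]
  exact Real.exp_le_exp.2 h1

theorem IsMonotone.congr {P : Measure Ω} {ρ : LinfPP P → ℝ≥0∞} (hρ : IsMonotone ρ)
    {X Y : LinfPP P} (h : X.1 =ᵐ[P] Y.1) : ρ X = ρ Y :=
  le_antisymm (hρ _ _ h.le) (hρ _ _ h.symm.le)

/-- The sublevel sets of `ρ`, in terms of logarithms. -/
def logSublevel {P : Measure Ω} (ρ : LinfPP P → ℝ≥0∞) (a : ℝ≥0∞) : Set (Ω → ℝ) :=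
  {f | ∃ hf : MemLp f ∞ P, ρ (ofLog f hf) ≤ a}

theorem log_mem_logSublevel {P : Measure Ω} {ρ : LinfPP P → ℝ≥0∞} (hρ : IsMonotone ρ)
    {a : ℝ≥0∞} {X : LinfPP P} : (fun ω => Real.log (X.1 ω)) ∈ logSublevel ρ a ↔ ρ X ≤ a := by
  have h := hρ.congr (ofLog_log X)
  constructor
  · rintro ⟨hf, hle⟩
    rwa [h] at hle
  · intro hle
    exact ⟨memLp_log X, by rwa [h]⟩

theorem logSublevel_down {P : Measure Ω} {ρ : LinfPP P → ℝ≥0∞} (hρ : IsMonotone ρ)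
    {a : ℝ≥0∞} {f g : Ω → ℝ} (hf : f ∈ logSublevel ρ a) (hg : MemLp g ∞ P)
    (h : ∀ᵐ ω ∂P, g ω ≤ f ω) : g ∈ logSublevel ρ a := by
  obtain ⟨hf, hle⟩ := hf
  exact ⟨hg, (hρ.ofLog_le hg hf h).trans hle⟩

/-- The logarithm turns weighted geometric means into convex combinations. The weights 0 and 1 are
treated apart because quasi-logconvexity only speaks of weights strictly between. -/
theorem convex_logSublevel {P : Measure Ω} {ρ : LinfPP P → ℝ≥0∞} (hρ : IsMonotone ρ)
    (hq : IsQuasiLogconvex ρ) (a : ℝ≥0∞) : Convex ℝ (logSublevel ρ a) := by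
  rintro f hf g hg s t hs ht hst
  rcases hs.eq_or_lt with rfl | hs
  · obtain rfl : t = 1 := by linarith
    simpa using hg
  rcases ht.eq_or_lt with rfl | ht
  · obtain rfl : s = 1 := by linarith
    simpa using hf
  obtain ⟨hf, hfa⟩ := hf
  obtain ⟨hg, hga⟩ := hg
  have hm : MemLp (s • f + t • g) ∞ P := (hf.const_smul s).add (hg.const_smul t)
  have hs1 : s < 1 := by linarith
  refine ⟨hm, le_trans (le_trans (hρ _ _ ?_) (hq (ofLog f hf) (ofLog g hg) s hs hs1))
    (max_le hfa hga)⟩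
  filter_upwards [coeFn_ofLog hm, log_geomMean (ofLog f hf) (ofLog g hg) hs hs1, log_ofLog hf,
    log_ofLog hg, pos_ae (geomMean (ofLog f hf) (ofLog g hg) s hs hs1)] with ω h1 h2 h3 h4 h5
  rw [h1, ← Real.exp_log h5, h2, h3, h4]
  obtain rfl : t = 1 - s := by linarith
  exact le_rfl

/-- The infima of the tails of the sequence increase to the limit and lie below its members, so they
stay in the sublevel set by monotonicity. Continuity from below then applies to them. -/
theorem fatouClosed_logSublevel {P : Measure Ω} {ρ : LinfPP P → ℝ≥0∞} (hρ : IsMonotone ρ)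
    (hc : IsContinuousFromBelow ρ) (a : ℝ≥0∞) : FatouClosed P (logSublevel ρ a) := by
  intro f g M hf hM hg hlim
  have hgL : MemLp g ∞ P := memLp_top_of_tendsto hM hg hlim
  let h : ℕ → Ω → ℝ := fun n ω => ⨅ k, f (n + k) ω
  have hMall : ∀ᵐ ω ∂P, ∀ n, |f n ω| ≤ M := ae_all_iff.2 hM
  have hbdd : ∀ ω, (∀ n, |f n ω| ≤ M) → ∀ n, BddBelow (range fun k => f (n + k) ω) := by
    rintro ω hω n
    exact ⟨-M, by rintro _ ⟨k, rfl⟩; exact (abs_le.1 (hω _)).1⟩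
  have hle : ∀ ω, (∀ n, |f n ω| ≤ M) → ∀ n, h n ω ≤ f n ω := fun ω hω n =>
    ciInf_le (hbdd ω hω n) 0
  have hge : ∀ ω, (∀ n, |f n ω| ≤ M) → ∀ n, -M ≤ h n ω := fun ω hω n =>
    le_ciInf fun k => (abs_le.1 (hω _)).1
  have hmono : ∀ ω, (∀ n, |f n ω| ≤ M) → Monotone fun n => h n ω := by
    intro ω hω m n hmn
    refine le_ciInf fun k => ?_
    obtain ⟨d, rfl⟩ := Nat.exists_eq_add_of_le hmn
    have := ciInf_le (hbdd ω hω m) (d + k)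
    rwa [← add_assoc] at this
  have hL : ∀ n, MemLp (h n) ∞ P := by
    intro n
    refine memLp_top_of_bound (AEMeasurable.iInf fun k =>
      (hf (n + k)).1.1.aemeasurable).aestronglyMeasurable M ?_
    filter_upwards [hMall] with ω hω
    exact abs_le.2 ⟨hge ω hω n, (hle ω hω n).trans (abs_le.1 (hω n)).2⟩
  have hlim' : ∀ᵐ ω ∂P, Tendsto (fun n => h n ω) atTop (𝓝 (g ω)) := by
    filter_upwards [hMall, hlim] with ω hω hg
    rw [Metric.tendsto_atTop] at hg ⊢
    intro ε hε
    obtain ⟨N, hN⟩ := hg (ε / 2) (by positivity)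
    refine ⟨N, fun n hn => ?_⟩
    have h1 : g ω - ε / 2 ≤ h n ω := le_ciInf fun k => by
      have := hN (n + k) (by omega)
      rw [Real.dist_eq] at this
      linarith [(abs_lt.1 this).1]
    have h2 := hN n hn
    rw [Real.dist_eq] at h2 ⊢
    have h3 := hle ω hω n
    exact abs_lt.2 ⟨by linarith, by linarith [(abs_lt.1 h2).2]⟩
  have hT := hc (fun n => ofLog (h n) (hL n)) (ofLog g hgL) (by
    filter_upwards [hMall, hlim', ae_all_iff.2 fun n => coeFn_ofLog (hL n), coeFn_ofLog hgL]
      with ω h1 h2 h3 h4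
    simp only [h3, h4]
    exact ⟨fun m n hmn => Real.exp_le_exp.2 (hmono ω h1 hmn),
      (Real.continuous_exp.tendsto _).comp h2⟩)
  refine ⟨hgL, le_of_tendsto' hT fun n => ?_⟩
  exact (logSublevel_down hρ (hf n) (hL n) (hMall.mono fun ω hω => hle ω hω n)).2

/-! ### The dual representation and its converse -/

theorem dualFunction_mono {P : Measure Ω} (ρ : LinfPP P → ℝ≥0∞) (Q : DualMeasure P) :
    Monotone fun t => dualFunction ρ t Q := fun _ _ hst =>
  le_iInf₂ fun Y hY => iInf₂_le Y (hst.trans hY)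

theorem dualFunction_expLog_le {P : Measure Ω} (ρ : LinfPP P → ℝ≥0∞) (X : LinfPP P)
    (Q : DualMeasure P) : dualFunction ρ (expLog Q X) Q ≤ ρ X :=
  iInf₂_le (f := fun (Y : LinfPP P) (_ : expLog Q X ≤ expLog Q Y) => ρ Y) X le_rfl

theorem integrable_of_memLp_top {P : Measure Ω} (Q : DualMeasure P) {f : Ω → ℝ}
    (hf : MemLp f ∞ P) : Integrable f Q.1 := by
  have := Q.2.1
  obtain ⟨M, hM⟩ := exists_ae_abs_le hf
  exact Integrable.of_bound (hf.1.mono_ac Q.2.2) M (Q.2.2.ae_le hM)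

/-- The dual representation. -/
theorem isRepresentedBy_dualFunction {P : Measure Ω} [IsProbabilityMeasure P]
    {ρ : LinfPP P → ℝ≥0∞} (hρ : IsMonotone ρ) (hq : IsQuasiLogconvex ρ)
    (hc : IsContinuousFromBelow ρ) : IsRepresentedBy ρ (dualFunction ρ) := by
  intro X
  refine le_antisymm ?_ (iSup_le fun Q => dualFunction_expLog_le ρ X Q)
  refine le_of_forall_lt_imp_le_of_dense fun a ha => ?_
  suffices h : ∃ Q : DualMeasure P, ∀ Y, expLog Q X ≤ expLog Q Y → a ≤ ρ Y by
    obtain ⟨Q, hQ⟩ := h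
    exact le_iSup_of_le Q (le_iInf₂ hQ)
  -- Separation needs a nonempty sublevel set. If it is empty, every Q works, in particular P.
  by_cases hne : ∃ Y, ρ Y ≤ a
  swap
  · push Not at hne
    exact ⟨⟨P, inferInstance, Measure.AbsolutelyContinuous.rfl⟩, fun Y _ => (hne Y).le⟩
  have hclosed := fatouClosed_logSublevel hρ hc a
  have hX := memLp_log X
  obtain ⟨M, hM⟩ := exists_ae_abs_le hX
  obtain ⟨ε, hε, hεX⟩ : ∃ ε : ℝ, 0 < ε ∧
      (fun ω => Real.log (X.1 ω) - ε) ∉ logSublevel ρ a := by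
    by_contra! hcon
    refine ha.not_ge ((log_mem_logSublevel hρ).1 (hclosed
      (fun n ω => Real.log (X.1 ω) - 1 / ((n : ℝ) + 1)) _ (M + 1)
      (fun n => hcon _ (by positivity)) (fun n => ?_) hX.1 (ae_of_all _ fun ω => ?_)))
    · filter_upwards [hM] with ω hω
      have h1 : (0 : ℝ) < 1 / ((n : ℝ) + 1) := by positivity
      have h2 : 1 / ((n : ℝ) + 1) ≤ 1 := by
        rw [div_le_one (by positivity)]
        linarith [(n.cast_nonneg : (0 : ℝ) ≤ n)]
      have := abs_le.1 hω
      exact abs_le.2 ⟨by linarith, by linarith⟩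
    · simpa using (tendsto_one_div_add_atTop_nhds_zero_nat (𝕜 := ℝ)).const_sub
        (Real.log (X.1 ω))
  -- This affine change of variable sends -1 to log X - ε and 0 to log X, which is the normalisation
  -- of `exists_dualMeasure_neg`.
  let S : (Ω → ℝ) → Ω → ℝ := fun f ω => Real.log (X.1 ω) + ε * f ω
  have hS : ∀ f, MemLp (S f) ∞ P → MemLp f ∞ P := fun f hf => by
    have := (hf.sub hX).const_smul ε⁻¹
    refine (memLp_congr_ae (ae_of_all _ fun ω => ?_)).1 this
    simp only [S, Pi.smul_apply, Pi.sub_apply, smul_eq_mul]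
    field_simp
    ring
  have hsep : ∃ Q : DualMeasure P, ∀ f ∈ {f | S f ∈ logSublevel ρ a}, ∫ ω, f ω ∂Q.1 < 0 := by
    refine exists_dualMeasure_neg ?_ ?_ ?_ ?_ ?_ ?_
    · obtain ⟨Y, hY⟩ := hne
      refine ⟨fun ω => (Real.log (Y.1 ω) - Real.log (X.1 ω)) / ε, ?_⟩
      have : S (fun ω => (Real.log (Y.1 ω) - Real.log (X.1 ω)) / ε) =
          fun ω => Real.log (Y.1 ω) := by
        ext ω
        simp only [S]
        field_simp
        ring
      rw [mem_ofPred_eq, this]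
      exact (log_mem_logSublevel hρ).2 hY
    · exact fun f hf => hS f hf.1
    · intro f hf g hg s t hs ht hst
      have : S (s • f + t • g) = s • S f + t • S g := by
        ext ω
        simp only [S, Pi.add_apply, Pi.smul_apply, smul_eq_mul]
        linear_combination -Real.log (X.1 ω) * hst
      rw [mem_ofPred_eq, this]
      exact convex_logSublevel hρ hq a hf hg hs ht hst
    · intro f hf g hg h
      refine logSublevel_down hρ hf (hX.add (hg.const_smul ε)) ?_
      filter_upwards [h] with ω hω
      exact add_le_add_right (mul_le_mul_of_nonneg_left hω hε.le) _
    · intro f g M' hf hM' hg hlim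
      refine hclosed (fun n => S (f n)) _ (M + ε * M') hf (fun n => ?_)
        (hX.1.add (hg.const_mul ε)) (hlim.mono fun ω hω => (hω.const_mul ε).const_add _)
      filter_upwards [hM, hM' n] with ω h1 h2
      refine (abs_add_le _ _).trans (add_le_add h1 ?_)
      rw [abs_mul, abs_of_pos hε]
      exact mul_le_mul_of_nonneg_left h2 hε.le
    · intro h
      refine hεX ?_
      have h1 : S (fun _ => -1) ∈ logSublevel ρ a := h
      have h2 : S (fun _ => -1) = fun ω => Real.log (X.1 ω) - ε := by
        ext ω
        simp only [S]
        ring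
      rwa [h2] at h1
  obtain ⟨Q, hQ⟩ := hsep
  refine ⟨Q, fun Y hY => ?_⟩
  by_contra! hlt
  have h1 := hQ (fun ω => (Real.log (Y.1 ω) - Real.log (X.1 ω)) / ε) (by
    have : S (fun ω => (Real.log (Y.1 ω) - Real.log (X.1 ω)) / ε) =
        fun ω => Real.log (Y.1 ω) := by
      ext ω
      simp only [S]
      field_simp
      ring
    rw [mem_ofPred_eq, this]
    exact (log_mem_logSublevel hρ).2 hlt.le)
  rw [integral_div, integral_sub (integrable_of_memLp_top Q (memLp_log Y))
    (integrable_of_memLp_top Q hX)] at h1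
  have h2 : 0 ≤ (expLog Q Y - expLog Q X) / ε := div_nonneg (sub_nonneg.2 hY) hε.le
  exact h1.not_ge h2

theorem expLog_mono {P : Measure Ω} (Q : DualMeasure P) {X Y : LinfPP P}
    (h : ∀ᵐ ω ∂P, X.1 ω ≤ Y.1 ω) : expLog Q X ≤ expLog Q Y := by
  refine integral_mono_ae (integrable_of_memLp_top Q (memLp_log X))
    (integrable_of_memLp_top Q (memLp_log Y)) (Q.2.2.ae_le ?_)
  filter_upwards [h, pos_ae X] with ω h1 h2
  exact Real.log_le_log h2 h1

theorem expLog_geomMean {P : Measure Ω} (Q : DualMeasure P) (X Y : LinfPP P) {a : ℝ}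
    (h0 : 0 < a) (h1 : a < 1) :
    expLog Q (geomMean X Y a h0 h1) = a * expLog Q X + (1 - a) * expLog Q Y := by
  rw [expLog, integral_congr_ae (Q.2.2.ae_eq (log_geomMean X Y h0 h1)),
    integral_add ((integrable_of_memLp_top Q (memLp_log X)).const_mul a)
      ((integrable_of_memLp_top Q (memLp_log Y)).const_mul (1 - a)),
    integral_const_mul, integral_const_mul]
  rfl

theorem IsRepresentedBy.isMonotone {P : Measure Ω} {ρ : LinfPP P → ℝ≥0∞}
    (h : IsRepresentedBy ρ (dualFunction ρ)) : IsMonotone ρ := fun X Y hXY => by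
  rw [h X, h Y]
  exact iSup_mono fun Q => dualFunction_mono ρ Q (expLog_mono Q hXY)

/-- E_Q log of a geometric mean is a convex combination of E_Q log X and E_Q log Y, hence at most
the larger. The dual function is monotone in t, and at E_Q log X it is at most ρ(X). -/
theorem IsRepresentedBy.isQuasiLogconvex {P : Measure Ω} {ρ : LinfPP P → ℝ≥0∞}
    (h : IsRepresentedBy ρ (dualFunction ρ)) : IsQuasiLogconvex ρ := fun X Y a h0 h1 => by
  rw [h (geomMean X Y a h0 h1)]
  refine iSup_le fun Q => ?_
  rcases le_total (expLog Q X) (expLog Q Y) with hle | hle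
  · refine le_max_of_le_right (le_trans (dualFunction_mono ρ Q ?_)
      (dualFunction_expLog_le ρ Y Q))
    rw [expLog_geomMean]
    nlinarith
  · refine le_max_of_le_left (le_trans (dualFunction_mono ρ Q ?_)
      (dualFunction_expLog_le ρ X Q))
    rw [expLog_geomMean]
    nlinarith

/-- For each fixed Q the numbers E_Q log X_n increase to E_Q log X by monotone convergence, so left
continuity bounds each term of the supremum for ρ(X) by sup ρ(X_n). -/
theorem IsRepresentedBy.isContinuousFromBelow {P : Measure Ω} {ρ : LinfPP P → ℝ≥0∞}
    (h : IsRepresentedBy ρ (dualFunction ρ)) (hR : IsDualContinuousFromBelow (dualFunction ρ)) :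
    IsContinuousFromBelow ρ := by
  intro Xn X hX
  have hle : ∀ n, ∀ᵐ ω ∂P, (Xn n).1 ω ≤ X.1 ω := fun n => hX.mono fun ω hω =>
    hω.1.ge_of_tendsto hω.2 n
  have hmono : Monotone fun n => ρ (Xn n) := fun m n hmn =>
    h.isMonotone _ _ (hX.mono fun ω hω => hω.1 hmn)
  have hlim := tendsto_atTop_iSup hmono
  suffices hsup : ⨆ n, ρ (Xn n) = ρ X by rwa [hsup] at hlim
  refine le_antisymm (iSup_le fun n => h.isMonotone _ _ (hle n)) ?_
  rw [h X]
  refine iSup_le fun Q => ?_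
  have hexp : Tendsto (fun n => expLog Q (Xn n)) atTop (𝓝 (expLog Q X)) := by
    have h0 := Q.2.2.ae_le (pos_ae (Xn 0))
    have hX' : ∀ᵐ ω ∂Q.1, Monotone (fun n => (Xn n).1 ω) ∧
      Tendsto (fun n => (Xn n).1 ω) atTop (𝓝 (X.1 ω)) := Q.2.2.ae_le hX
    refine integral_tendsto_of_tendsto_of_monotone
      (fun n => integrable_of_memLp_top Q (memLp_log (Xn n)))
      (integrable_of_memLp_top Q (memLp_log X)) ?_ ?_
    · filter_upwards [h0, hX'] with ω h1 h2 m n hmn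
      exact Real.log_le_log (lt_of_lt_of_le h1 (h2.1 (Nat.zero_le m))) (h2.1 hmn)
    · filter_upwards [h0, hX'] with ω h1 h2
      have h3 : 0 < X.1 ω := lt_of_lt_of_le h1 (h2.1.ge_of_tendsto h2.2 0)
      exact (Real.continuousAt_log h3.ne').tendsto.comp h2.2
  have hT := (hR Q (expLog Q X)).tendsto.comp (tendsto_nhdsWithin_iff.2
    ⟨hexp, Eventually.of_forall fun n => expLog_mono Q (hle n)⟩)
  exact le_of_tendsto' hT fun n =>
    (dualFunction_expLog_le ρ (Xn n) Q).trans (le_iSup (fun n => ρ (Xn n)) n)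

/-! ### Continuous laws on a non-atomic space -/

/-- The probability that `h` takes the same value at two independent points. -/
noncomputable def collision (P : Measure Ω) (h : Ω → ℝ) : ℝ≥0∞ :=
  (P.prod P) {p | h p.1 = h p.2}

/-- A minimising sequence is encoded injectively in one real variable through a measurable embedding
of the sequence space; its collisions are collisions of every member of the sequence. -/
theorem exists_collision_minimal (P : Measure Ω) [IsProbabilityMeasure P] :
    ∃ H : Ω → ℝ, Measurable H ∧ ∀ h, Measurable h → collision P H ≤ collision P h := by
  let m : ℝ≥0∞ := ⨅ h : {h : Ω → ℝ // Measurable h}, collision P h.1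
  have hm : m ≠ ∞ := ne_top_of_le_ne_top (measure_ne_top (P.prod P) _)
    (iInf_le (fun h : {h : Ω → ℝ // Measurable h} => collision P h.1) ⟨0, measurable_zero⟩)
  have hex : ∀ n : ℕ, ∃ h : {h : Ω → ℝ // Measurable h},
      collision P h.1 < m + ((n : ℝ≥0∞) + 1)⁻¹ := fun n =>
    iInf_lt_iff.1 (ENNReal.lt_add_right hm (ENNReal.inv_ne_zero.2 (by finiteness)))
  choose h hh using hex
  let H : Ω → ℝ := fun ω => embeddingReal (ℕ → ℝ) fun n => (h n).1 ω
  have hH : Measurable H := (measurable_embeddingReal (ℕ → ℝ)).comp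
    (measurable_pi_lambda _ fun n => (h n).2)
  have hle : ∀ n, collision P H ≤ collision P (h n).1 := fun n =>
    measure_mono fun p hp =>
      congrFun ((measurableEmbedding_embeddingReal (ℕ → ℝ)).injective hp) n
  have hHm : collision P H ≤ m := by
    have h1 : Tendsto (fun n : ℕ => m + ((n : ℝ≥0∞) + 1)⁻¹) atTop (𝓝 (m + 0)) := by
      refine Tendsto.const_add _ ?_
      have := (tendsto_add_atTop_iff_nat 1).2 ENNReal.tendsto_inv_nat_nhds_zero
      simpa using this
    rw [add_zero] at h1
    exact ge_of_tendsto' h1 fun n => (hle n).trans (hh n).le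
  exact ⟨H, hH, fun k hk => hHm.trans
    (iInf_le (fun h : {h : Ω → ℝ // Measurable h} => collision P h.1) ⟨k, hk⟩)⟩

/-- On a non-atomic probability space there is a random variable with continuous distribution. -/
theorem NonAtomic.exists_continuous_law {P : Measure Ω} [IsProbabilityMeasure P]
    (hP : NonAtomic P) : ∃ h : Ω → ℝ, Measurable h ∧ ∀ c, P {ω | h ω = c} = 0 := by
  obtain ⟨H, hH, hmin⟩ := exists_collision_minimal P
  refine ⟨H, hH, fun c => ?_⟩
  by_contra hne
  have hA : MeasurableSet {ω | H ω = c} := hH (measurableSet_singleton c)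
  obtain ⟨B, hBA, hB, hB0, hBlt⟩ := hP _ hA (pos_iff_ne_zero.2 hne)
  -- If H had an atom, recording also whether ω lies in B would remove the collisions in B × ({H =
  -- c} \ B), a set of positive measure, against minimality.
  let K : Ω → ℝ := fun ω => embeddingReal (ℝ × ℝ) (H ω, B.indicator (fun _ => 1) ω)
  have hK : Measurable K := (measurable_embeddingReal (ℝ × ℝ)).comp
    (hH.prodMk (measurable_const.indicator hB))
  have hsub : {p : Ω × Ω | K p.1 = K p.2} ⊆
      {p : Ω × Ω | H p.1 = H p.2} \ (B ×ˢ ({ω | H ω = c} \ B)) := by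
    intro p hp
    have h1 := (measurableEmbedding_embeddingReal (ℝ × ℝ)).injective hp
    rw [Prod.mk.injEq] at h1
    refine ⟨h1.1, fun h2 => ?_⟩
    have h3 := h1.2
    rw [indicator_of_mem h2.1, indicator_of_notMem h2.2.2] at h3
    exact one_ne_zero h3
  have hrect : (B ×ˢ ({ω | H ω = c} \ B)) ⊆ {p : Ω × Ω | H p.1 = H p.2} := fun p hp =>
    (hBA hp.1 : H p.1 = c).trans (hp.2.1 : H p.2 = c).symm
  have hpos : 0 < (P.prod P) (B ×ˢ ({ω | H ω = c} \ B)) := by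
    rw [Measure.prod_prod]
    refine ENNReal.mul_pos hB0.ne' ?_
    rw [measure_sdiff hBA hB.nullMeasurableSet (measure_ne_top _ _)]
    exact (tsub_pos_of_lt hBlt).ne'
  have h1 : collision P K < collision P H := by
    refine (measure_mono hsub).trans_lt ?_
    rw [measure_sdiff hrect (hB.prod (hA.diff hB)).nullMeasurableSet (measure_ne_top _ _)]
    exact ENNReal.sub_lt_self (measure_ne_top _ _) (hpos.trans_le (measure_mono hrect)).ne'
      hpos.ne'
  exact h1.not_ge (hmin K hK)

/-- On a non-atomic probability space every random variable is a strictly comonotone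
coarsening of one with continuous distribution. -/
theorem NonAtomic.exists_continuous_refinement {P : Measure Ω} [IsProbabilityMeasure P]
    (hP : NonAtomic P) {Z : Ω → ℝ} (hZ : Measurable Z) :
    ∃ W : Ω → ℝ, Measurable W ∧ (∀ c, P {ω | W ω = c} = 0) ∧
      ∀ ω ω', Z ω < Z ω' → W ω < W ω' := by
  obtain ⟨h, hh, hc⟩ := hP.exists_continuous_law
  let F : ℝ → ℝ := fun z => P.real {ω | Z ω < z}
  let G : ℝ → ℝ := fun z => P.real {ω | Z ω ≤ z}
  have hF : Monotone F := fun a b hab => measureReal_mono fun ω hω => lt_of_lt_of_le hω hab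
  have hG : Monotone G := fun a b hab => measureReal_mono fun ω hω => le_trans hω hab
  have hFG : ∀ z, F z ≤ G z := fun z => measureReal_mono fun ω (hω : Z ω < z) => hω.le
  have hGF : ∀ a b, a < b → G a ≤ F b := fun a b hab =>
    measureReal_mono fun ω hω => lt_of_le_of_lt hω hab
  -- Each atom of Z is spread by h over an interval as long as its mass, G - F. The summand Z makes
  -- W strictly monotone in Z even where F and G are flat.
  let W : Ω → ℝ := fun ω => Z ω + F (Z ω) + (G (Z ω) - F (Z ω)) * Real.sigmoid (h ω)
  have hW : Measurable W := by
    have h1 := hF.measurable.comp hZ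
    have h2 := hG.measurable.comp hZ
    exact (hZ.add h1).add ((h2.sub h1).mul (Real.sigmoid_monotone.measurable.comp hh))
  have hmono : ∀ ω ω', Z ω < Z ω' → W ω < W ω' := by
    intro ω ω' hlt
    have h1 : W ω ≤ Z ω + G (Z ω) := by
      have := mul_le_mul_of_nonneg_left (Real.sigmoid_le_one (h ω)) (sub_nonneg.2 (hFG (Z ω)))
      simp only [W]
      linarith
    have h2 : Z ω' + F (Z ω') ≤ W ω' := by
      have := mul_nonneg (sub_nonneg.2 (hFG (Z ω'))) (Real.sigmoid_nonneg (h ω'))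
      simp only [W]
      linarith
    linarith [hGF _ _ hlt]
  refine ⟨W, hW, fun c => ?_, hmono⟩
  rcases eq_empty_or_nonempty {ω | W ω = c} with he | ⟨ω₀, hω₀⟩
  · rw [he, measure_empty]
  have hZeq : ∀ ω, W ω = c → Z ω = Z ω₀ := by
    intro ω hω
    rcases lt_trichotomy (Z ω) (Z ω₀) with h1 | h1 | h1
    · exact absurd (hω.trans (Eq.symm hω₀)) (hmono _ _ h1).ne
    · exact h1
    · exact absurd (hω.trans (Eq.symm hω₀)) (hmono _ _ h1).ne'
  by_cases hz : G (Z ω₀) - F (Z ω₀) = 0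
  · refine measure_mono_null (t := {ω | Z ω ≤ Z ω₀} \ {ω | Z ω < Z ω₀})
      (fun ω hω => ⟨(hZeq ω hω).le, (hZeq ω hω).not_lt⟩) ?_
    have h1 := measureReal_sdiff (μ := P) (s₁ := {ω | Z ω ≤ Z ω₀}) (s₂ := {ω | Z ω < Z ω₀})
      (fun ω (hω : Z ω < Z ω₀) => hω.le) (measurableSet_lt hZ measurable_const)
    have h2 : P.real ({ω | Z ω ≤ Z ω₀} \ {ω | Z ω < Z ω₀}) = 0 := h1.trans hz
    exact (measureReal_eq_zero_iff (by finiteness)).1 h2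
  · refine measure_mono_null (fun ω hω => ?_) (hc (h ω₀))
    have h1 : W ω = W ω₀ := Eq.trans hω (Eq.symm hω₀)
    simp only [W, hZeq ω hω, add_right_inj] at h1
    exact Real.sigmoid_injective (mul_left_cancel₀ hz h1)

/-- The probability integral transform of a random variable with continuous distribution. -/
theorem map_measureReal_le_eq_uniform {P : Measure Ω} [IsProbabilityMeasure P] {W : Ω → ℝ}
    (hW : Measurable W) (hc : ∀ c, P {ω | W ω = c} = 0) :
    Measurable (fun ω => P.real {ω' | W ω' ≤ W ω}) ∧
      P.map (fun ω => P.real {ω' | W ω' ≤ W ω}) = volume.restrict (Ioo 0 1) := by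
  have hprob : IsProbabilityMeasure (P.map W) := Measure.isProbabilityMeasure_map hW.aemeasurable
  let F : ℝ → ℝ := cdf (P.map W)
  have hFr : ∀ x, P.real {ω' | W ω' ≤ x} = F x := fun x => by
    simp only [F]
    rw [cdf_eq_real, map_measureReal_apply hW measurableSet_Iic]
    rfl
  simp only [hFr]
  have hmono : Monotone F := monotone_cdf _
  have hcont : Continuous F := by
    refine continuous_iff_continuousAt.2 fun x => ?_
    rw [hmono.continuousAt_iff_leftLim_eq_rightLim]
    have h1 := (cdf (P.map W)).measure_singleton x
    rw [measure_cdf, Measure.map_apply hW (measurableSet_singleton x)] at h1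
    have h2 : P (W ⁻¹' {x}) = 0 := hc x
    rw [h2, eq_comm, ENNReal.ofReal_eq_zero, sub_nonpos] at h1
    exact le_antisymm (hmono.leftLim_le_rightLim le_rfl)
      ((StieltjesFunction.rightLim_eq _ x).le.trans h1)
  have hU : Measurable fun ω => F (W ω) := hcont.measurable.comp hW
  refine ⟨hU, ?_⟩
  have hmid : ∀ u ∈ Ioo (0 : ℝ) 1, P {ω | F (W ω) ≤ u} = ENNReal.ofReal u := by
    intro u hu
    -- F may be flat, so it is inverted at u by the largest point of this set, where continuity
    -- gives F = u.
    let S : Set ℝ := {x | F x ≤ u}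
    obtain ⟨a, ha⟩ := ((tendsto_cdf_atBot (P.map W)).eventually (gt_mem_nhds hu.1)).exists
    obtain ⟨b, hb⟩ := ((tendsto_cdf_atTop (P.map W)).eventually (lt_mem_nhds hu.2)).exists
    obtain ⟨w, hw⟩ := mem_range_of_exists_le_of_exists_ge hcont ⟨a, le_of_lt ha⟩ ⟨b, le_of_lt hb⟩
    have hwS : w ∈ S := le_of_eq hw
    have hSb : BddAbove S := ⟨b, fun x hx => by
      by_contra! hlt
      exact absurd (hb.trans_le (hmono hlt.le)) (not_lt.2 hx)⟩
    have hScl : IsClosed S := isClosed_le hcont continuous_const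
    have hmem : sSup S ∈ S := hScl.csSup_mem ⟨w, hwS⟩ hSb
    have hval : F (sSup S) = u := le_antisymm hmem (hw.symm.le.trans (hmono (le_csSup hSb hwS)))
    have hset : {ω | F (W ω) ≤ u} = {ω | W ω ≤ sSup S} := by
      ext ω
      exact ⟨fun hω => le_csSup hSb hω, fun hω => (hmono hω).trans hmem⟩
    rw [hset, ← hval, ← hFr, ofReal_measureReal]
  have hlow : ∀ u ≤ (0 : ℝ), P {ω | F (W ω) ≤ u} = 0 := by
    intro u hu
    refine le_antisymm (ENNReal.le_of_forall_pos_le_add fun ε hε _ => ?_) zero_le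
    have hε' : min (ε : ℝ) (1 / 2) ∈ Ioo (0 : ℝ) 1 :=
      ⟨lt_min hε (by norm_num), (min_le_right _ _).trans_lt (by norm_num)⟩
    calc P {ω | F (W ω) ≤ u} ≤ P {ω | F (W ω) ≤ min (ε : ℝ) (1 / 2)} :=
          measure_mono fun ω hω => le_trans hω (hu.trans hε'.1.le)
      _ = ENNReal.ofReal (min (ε : ℝ) (1 / 2)) := hmid _ hε'
      _ ≤ ENNReal.ofReal ε := ENNReal.ofReal_le_ofReal (min_le_left _ _)
      _ = 0 + ε := by simp
  have hprobU : IsProbabilityMeasure (P.map fun ω => F (W ω)) :=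
    Measure.isProbabilityMeasure_map hU.aemeasurable
  refine Measure.ext_of_Iic _ _ fun u => ?_
  rw [Measure.map_apply hU measurableSet_Iic, Measure.restrict_apply measurableSet_Iic]
  change P {ω | F (W ω) ≤ u} = _
  rcases le_or_gt u 0 with h0 | h0
  · have : Iic u ∩ Ioo (0 : ℝ) 1 = ∅ := by
      ext x
      simp only [mem_inter_iff, mem_Iic, mem_Ioo, mem_empty_iff_false, iff_false]
      rintro ⟨h1, h2, -⟩
      linarith
    rw [hlow u h0, this, measure_empty]
  rcases lt_or_ge u 1 with h1 | h1
  · have : Iic u ∩ Ioo (0 : ℝ) 1 = Ioc 0 u := by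
      ext x
      simp only [mem_inter_iff, mem_Iic, mem_Ioo, mem_Ioc]
      constructor
      · rintro ⟨h2, h3, -⟩
        exact ⟨h3, h2⟩
      · rintro ⟨h2, h3⟩
        exact ⟨h3, h2, h3.trans_lt h1⟩
    rw [hmid u ⟨h0, h1⟩, this, Real.volume_Ioc, sub_zero]
  · have hset : {ω | F (W ω) ≤ u} = univ := eq_univ_of_forall fun ω => (cdf_le_one _ _).trans h1
    have : Iic u ∩ Ioo (0 : ℝ) 1 = Ioo 0 1 :=
      inter_eq_right.2 fun x hx => hx.2.le.trans h1
    rw [hset, this, measure_univ, Real.volume_Ioo]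
    simp

/-! ### Comonotonicity and quantile functions -/

/-- `f` and `g` are comonotone off a null set. -/
def Comonotone (P : Measure Ω) (f g : Ω → ℝ) : Prop :=
  ∃ s ∈ ae P, ∀ ω ∈ s, ∀ ω' ∈ s, g ω < g ω' → f ω ≤ f ω'

theorem Comonotone.symm {P : Measure Ω} {f g : Ω → ℝ} (h : Comonotone P f g) :
    Comonotone P g f := by
  obtain ⟨s, hs, h⟩ := h
  refine ⟨s, hs, fun ω hω ω' hω' hlt => ?_⟩
  by_contra! hlt'
  exact hlt.not_ge (h ω' hω' ω hω hlt')

/-- If q b < q a with a < b, then b ≤ P(Z ≤ q b) ≤ P(Z < q a) ≤ a. -/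
theorem IsQuantileFunction.monotoneOn {P : Measure Ω} {Z : Ω → ℝ} {q : ℝ → ℝ}
    (hq : IsQuantileFunction P Z q) : MonotoneOn q (Ioo 0 1) := by
  intro a ha b hb hab
  rcases hab.eq_or_lt with rfl | hab
  · exact le_rfl
  by_contra! hlt
  have h1 : P {ω | Z ω ≤ q b} ≤ P {ω | Z ω < q a} :=
    measure_mono fun ω hω => lt_of_le_of_lt hω hlt
  have h2 := ((hq b hb).2.trans h1).trans (hq a ha).1
  exact hab.not_ge ((ENNReal.ofReal_le_ofReal_iff ha.1.le).1 h2)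

/-- Within (0,1), the set {q ≤ x} lies between (0, F x) and (0, F x], F being the distribution
function of Z. The choice of quantiles thus affects only a null set. -/
theorem IsQuantileFunction.identDistrib {P : Measure Ω} [IsProbabilityMeasure P] {Z : Ω → ℝ}
    {q : ℝ → ℝ} (hq : IsQuantileFunction P Z q) (hZ : AEMeasurable Z P) :
    IdentDistrib Z q P (volume.restrict (Ioo 0 1)) := by
  have hqm : AEMeasurable q (volume.restrict (Ioo 0 1)) :=
    aemeasurable_restrict_of_monotoneOn measurableSet_Ioo hq.monotoneOn
  refine ⟨hZ, hqm, ?_⟩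
  have := Measure.isProbabilityMeasure_map hZ
  refine Measure.ext_of_Iic _ _ fun x => ?_
  rw [Measure.map_apply_of_aemeasurable hZ measurableSet_Iic,
    Measure.map_apply_of_aemeasurable hqm measurableSet_Iic,
    Measure.restrict_apply' measurableSet_Ioo]
  have hF : P (Z ⁻¹' Iic x) = ENNReal.ofReal (P.real {ω | Z ω ≤ x}) := (ofReal_measureReal).symm
  have h1 : P.real {ω | Z ω ≤ x} ≤ 1 := measureReal_le_one
  refine le_antisymm ?_ ?_
  · calc P (Z ⁻¹' Iic x) = volume (Ioo 0 (P.real {ω | Z ω ≤ x})) := by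
          rw [hF, Real.volume_Ioo, sub_zero]
      _ ≤ _ := measure_mono fun b hb => by
          refine ⟨?_, hb.1, hb.2.trans_le h1⟩
          by_contra hlt
          have hlt' : x < q b := not_le.1 hlt
          have h2 : P {ω | Z ω ≤ x} ≤ P {ω | Z ω < q b} :=
            measure_mono fun ω hω => lt_of_le_of_lt hω hlt'
          have h3 := h2.trans (hq b ⟨hb.1, hb.2.trans_le h1⟩).1
          exact hb.2.not_ge (ENNReal.toReal_le_of_le_ofReal hb.1.le h3)
  · calc volume (q ⁻¹' Iic x ∩ Ioo 0 1) ≤ volume (Ioc 0 (P.real {ω | Z ω ≤ x})) :=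
          measure_mono fun b hb => by
          refine ⟨hb.2.1, ?_⟩
          have h2 : P {ω | Z ω ≤ q b} ≤ P {ω | Z ω ≤ x} :=
            measure_mono fun ω (hω : Z ω ≤ q b) => hω.trans hb.1
          exact (ENNReal.ofReal_le_iff_le_toReal (measure_ne_top _ _)).1
            ((hq b hb.2).2.trans h2)
      _ = P (Z ⁻¹' Iic x) := by rw [hF, Real.volume_Ioc, sub_zero]

theorem exists_isQuantileFunction {P : Measure Ω} [IsProbabilityMeasure P] {Z : Ω → ℝ}
    (hZ : AEMeasurable Z P) : ∃ q, IsQuantileFunction P Z q := by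
  have hprob := Measure.isProbabilityMeasure_map hZ
  let F : ℝ → ℝ := cdf (P.map Z)
  have hmono : Monotone F := monotone_cdf _
  have hFP : ∀ x, P {ω | Z ω ≤ x} = ENNReal.ofReal (F x) := fun x => by
    simp only [F]
    rw [ofReal_cdf, Measure.map_apply_of_aemeasurable hZ measurableSet_Iic]
    rfl
  refine ⟨fun b => sInf {x | b ≤ F x}, fun b hb => ?_⟩
  obtain ⟨x₀, hx₀⟩ := ((tendsto_cdf_atBot (P.map Z)).eventually (gt_mem_nhds hb.1)).exists
  obtain ⟨x₁, hx₁⟩ := ((tendsto_cdf_atTop (P.map Z)).eventually (lt_mem_nhds hb.2)).exists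
  have hne : {x | b ≤ F x}.Nonempty := ⟨x₁, le_of_lt hx₁⟩
  have hbdd : BddBelow {x | b ≤ F x} := ⟨x₀, fun x hx => by
    by_contra! hlt
    exact absurd (lt_of_le_of_lt (hmono hlt.le) hx₀) (not_lt.2 hx)⟩
  set y := sInf {x | b ≤ F x} with hy
  constructor
  · have hU : {ω | Z ω < y} = ⋃ n : ℕ, {ω | Z ω ≤ y - 1 / ((n : ℝ) + 1)} := by
      ext ω
      simp only [mem_ofPred_eq, mem_iUnion]
      constructor
      · intro hω
        obtain ⟨n, hn⟩ := exists_nat_one_div_lt (sub_pos.2 hω)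
        exact ⟨n, by linarith⟩
      · rintro ⟨n, hn⟩
        have : (0 : ℝ) < 1 / ((n : ℝ) + 1) := by positivity
        linarith
    have hmonoU : Monotone fun n : ℕ => {ω | Z ω ≤ y - 1 / ((n : ℝ) + 1)} := by
      intro m n hmn ω hω
      have h1 : Z ω ≤ y - 1 / ((m : ℝ) + 1) := hω
      have := Nat.one_div_le_one_div (α := ℝ) hmn
      change Z ω ≤ y - 1 / ((n : ℝ) + 1)
      linarith
    rw [hU]
    refine le_of_tendsto' (tendsto_measure_iUnion_atTop hmonoU) fun n => ?_
    change P {ω | Z ω ≤ y - 1 / ((n : ℝ) + 1)} ≤ _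
    rw [hFP]
    refine ENNReal.ofReal_le_ofReal ?_
    by_contra! hlt
    have h1 := csInf_le hbdd (show y - 1 / ((n : ℝ) + 1) ∈ {x | b ≤ F x} from hlt.le)
    have : (0 : ℝ) < 1 / ((n : ℝ) + 1) := by positivity
    linarith
  · rw [hFP]
    refine ENNReal.ofReal_le_ofReal ?_
    have hr : Tendsto F (𝓝[>] y) (𝓝 (F y)) :=
      ((cdf (P.map Z)).right_continuous y).mono_left (nhdsWithin_mono _ Ioi_subset_Ici_self)
    refine ge_of_tendsto hr ?_
    filter_upwards [self_mem_nhdsWithin] with x hx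
    obtain ⟨z, hz, hzx⟩ := exists_lt_of_csInf_lt hne (show sInf {x | b ≤ F x} < x from hx)
    exact le_trans hz (hmono hzx.le)

theorem IsQuantileFunction.comonotone {P : Measure Ω} {Z Z' : Ω → ℝ} {q q' : ℝ → ℝ}
    (hq : IsQuantileFunction P Z q) (hq' : IsQuantileFunction P Z' q') :
    Comonotone (volume.restrict (Ioo 0 1)) q q' := by
  refine ⟨Ioo 0 1, self_mem_ae_restrict measurableSet_Ioo, fun a ha b hb hlt => ?_⟩
  refine hq.monotoneOn ha hb ?_
  by_contra! hba
  exact hlt.not_ge (hq'.monotoneOn hb ha hba.le)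

/-- On a non-atomic probability space, every law is realised comonotonely with a given random
variable. -/
theorem NonAtomic.exists_comonotone {P : Measure Ω} [IsProbabilityMeasure P]
    (hP : NonAtomic P) {Z f : Ω → ℝ} (hZ : Measurable Z) (hf : AEMeasurable f P) :
    ∃ f' : Ω → ℝ, IdentDistrib f f' P P ∧ Comonotone P f' Z := by
  obtain ⟨W, hW, hWc, hWZ⟩ := hP.exists_continuous_refinement hZ
  obtain ⟨hU, hUmap⟩ := map_measureReal_le_eq_uniform hW hWc
  obtain ⟨q, hq⟩ := exists_isQuantileFunction hf
  have hid := hq.identDistrib hf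
  let U : Ω → ℝ := fun ω => P.real {ω' | W ω' ≤ W ω}
  have hqU : AEMeasurable q (P.map U) := by
    rw [hUmap]
    exact hid.aemeasurable_snd
  -- U is uniform and increasing in W, hence in Z, so q ∘ U has the law of f and rises with Z.
  refine ⟨q ∘ U, ⟨hf, hqU.comp_measurable hU, ?_⟩, U ⁻¹' Ioo 0 1, ?_, ?_⟩
  · rw [← AEMeasurable.map_map_of_aemeasurable hqU hU.aemeasurable, hUmap]
    exact hid.map_eq
  · refine (ae_map_iff (p := fun x => x ∈ Ioo (0 : ℝ) 1) hU.aemeasurable measurableSet_Ioo).1 ?_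
    change ∀ᵐ x ∂P.map U, x ∈ Ioo (0 : ℝ) 1
    rw [hUmap]
    exact ae_restrict_mem measurableSet_Ioo
  · intro ω hω ω' hω' hlt
    exact hq.monotoneOn hω hω' (measureReal_mono fun x hx => le_trans hx (hWZ _ _ hlt).le)

/-! ### The Hardy–Littlewood inequality -/

variable {Ω' : Type*} [MeasurableSpace Ω']

/-- The layer-cake formula is applied twice, first to f under the measure with density g, then to g.
It reduces expected products to joint probabilities of upper level sets. -/
theorem lintegral_mul_eq_lintegral_meas {P : Measure Ω} [IsProbabilityMeasure P] {f g : Ω → ℝ}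
    (hf : AEMeasurable f P) (hg : AEMeasurable g P) (hf0 : 0 ≤ᵐ[P] f) (hg0 : 0 ≤ᵐ[P] g) :
    ∫⁻ ω, ENNReal.ofReal (f ω) * ENNReal.ofReal (g ω) ∂P =
      ∫⁻ t in Ioi (0 : ℝ), ∫⁻ s in Ioi (0 : ℝ), P ({ω | s < g ω} ∩ {ω | t < f ω}) := by
  have hac := withDensity_absolutelyContinuous P fun ω => ENNReal.ofReal (g ω)
  calc ∫⁻ ω, ENNReal.ofReal (f ω) * ENNReal.ofReal (g ω) ∂P
      = ∫⁻ ω, ENNReal.ofReal (f ω) ∂P.withDensity fun ω => ENNReal.ofReal (g ω) := by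
        rw [lintegral_withDensity_eq_lintegral_mul₀ hg.ennreal_ofReal hf.ennreal_ofReal]
        exact lintegral_congr fun ω => mul_comm _ _
    _ = ∫⁻ t in Ioi (0 : ℝ), (P.withDensity fun ω => ENNReal.ofReal (g ω)) {ω | t < f ω} :=
        lintegral_eq_lintegral_meas_lt _ (hac.ae_le hf0) (hf.mono_ac hac)
    _ = _ := by
        refine lintegral_congr fun t => ?_
        rw [withDensity_apply', lintegral_eq_lintegral_meas_lt _ (ae_restrict_of_ae hg0)
          hg.restrict]
        refine lintegral_congr fun s => ?_
        exact Measure.restrict_apply₀ (nullMeasurableSet_lt aemeasurable_const hg.restrict)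

/-- The Hardy–Littlewood inequality: comonotone pairs maximise the expected product. -/
theorem Comonotone.lintegral_mul_le {P : Measure Ω} [IsProbabilityMeasure P] {P' : Measure Ω'}
    [IsProbabilityMeasure P'] {f g : Ω → ℝ} {f' g' : Ω' → ℝ} (hco : Comonotone P' f' g')
    (hf : IdentDistrib f f' P P') (hg : IdentDistrib g g' P P') (hf0 : 0 ≤ᵐ[P] f)
    (hg0 : 0 ≤ᵐ[P] g) :
    ∫⁻ ω, ENNReal.ofReal (f ω) * ENNReal.ofReal (g ω) ∂P ≤
      ∫⁻ ω, ENNReal.ofReal (f' ω) * ENNReal.ofReal (g' ω) ∂P' := by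
  rw [lintegral_mul_eq_lintegral_meas hf.aemeasurable_fst hg.aemeasurable_fst hf0 hg0,
    lintegral_mul_eq_lintegral_meas hf.aemeasurable_snd hg.aemeasurable_snd
      (hf.ae_snd (p := fun x => 0 ≤ x) measurableSet_Ici hf0)
      (hg.ae_snd (p := fun x => 0 ≤ x) measurableSet_Ici hg0)]
  refine lintegral_mono fun t => lintegral_mono fun s => ?_
  obtain ⟨S, hS, hco⟩ := hco
  have hft : P {ω | t < f ω} = P' {ω | t < f' ω} := hf.measure_mem_eq measurableSet_Ioi
  have hgs : P {ω | s < g ω} = P' {ω | s < g' ω} := hg.measure_mem_eq measurableSet_Ioi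
  -- Comonotonicity nests the two level sets up to a null set, so their intersection has the smaller
  -- of the two probabilities, the most the marginals allow.
  by_cases h : ∀ ω ∈ S, t < f' ω → s < g' ω
  · calc P ({ω | s < g ω} ∩ {ω | t < f ω}) ≤ P {ω | t < f ω} := measure_mono inter_subset_right
      _ = P' {ω | t < f' ω} := hft
      _ ≤ P' ({ω | s < g' ω} ∩ {ω | t < f' ω}) := measure_mono_ae (by
          filter_upwards [hS] with ω hω hlt
          exact ⟨h ω hω hlt, hlt⟩)
  · push Not at h
    obtain ⟨ω₀, hω₀, h1, h2⟩ := h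
    calc P ({ω | s < g ω} ∩ {ω | t < f ω}) ≤ P {ω | s < g ω} := measure_mono inter_subset_left
      _ = P' {ω | s < g' ω} := hgs
      _ ≤ P' ({ω | s < g' ω} ∩ {ω | t < f' ω}) := measure_mono_ae (by
          filter_upwards [hS] with ω hω hlt
          exact ⟨hlt, h1.trans_le (hco ω₀ hω₀ ω hω (lt_of_le_of_lt h2 hlt))⟩)

theorem integrable_mul_of_bounded {P : Measure Ω} {f g : Ω → ℝ} (hf : AEMeasurable f P)
    {M : ℝ} (hM : ∀ᵐ ω ∂P, |f ω| ≤ M) (hg : Integrable g P) :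
    Integrable (fun ω => f ω * g ω) P :=
  hg.bdd_mul hf.aestronglyMeasurable hM

/-- The Hardy–Littlewood inequality for a bounded and a nonnegative integrable variable. -/
theorem Comonotone.integral_mul_le {P : Measure Ω} [IsProbabilityMeasure P] {P' : Measure Ω'}
    [IsProbabilityMeasure P'] {f g : Ω → ℝ} {f' g' : Ω' → ℝ} (hco : Comonotone P' f' g')
    (hf : IdentDistrib f f' P P') (hg : IdentDistrib g g' P P') {M : ℝ}
    (hM : ∀ᵐ ω ∂P, |f ω| ≤ M) (hg0 : 0 ≤ᵐ[P] g) (hgi : Integrable g P) :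
    ∫ ω, f ω * g ω ∂P ≤ ∫ ω, f' ω * g' ω ∂P' := by
  have hM' : ∀ᵐ ω ∂P', |f' ω| ≤ M :=
    hf.ae_snd (p := fun x => |x| ≤ M) (measurableSet_le measurable_id.abs measurable_const) hM
  have hg0' : 0 ≤ᵐ[P'] g' := hg.ae_snd (p := fun x => 0 ≤ x) measurableSet_Ici hg0
  have hgi' : Integrable g' P' := hg.integrable_snd hgi
  have hfg := integrable_mul_of_bounded hf.aemeasurable_fst hM hgi
  have hfg' := integrable_mul_of_bounded hf.aemeasurable_snd hM' hgi'
  -- Adding M makes f nonnegative. It changes both sides by the same M·E g, which cancels at the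
  -- end.
  have hsh : IdentDistrib (fun ω => f ω + M) (fun ω => f' ω + M) P P' :=
    hf.comp (u := fun x => x + M) (measurable_id.add_const M)
  have hf0 : 0 ≤ᵐ[P] fun ω => f ω + M := by
    filter_upwards [hM] with ω hω
    change 0 ≤ f ω + M
    linarith [(abs_le.1 hω).1]
  have hf0' : 0 ≤ᵐ[P'] fun ω => f' ω + M := by
    filter_upwards [hM'] with ω hω
    change 0 ≤ f' ω + M
    linarith [(abs_le.1 hω).1]
  have hcosh : Comonotone P' (fun ω => f' ω + M) g' := by
    obtain ⟨S, hS, h⟩ := hco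
    exact ⟨S, hS, fun ω hω ω' hω' hlt => by simpa using h ω hω ω' hω' hlt⟩
  have hle := hcosh.lintegral_mul_le hsh hg hf0 hg0
  have hint : Integrable (fun ω => (f ω + M) * g ω) P := by
    simp only [add_mul]
    exact hfg.add (hgi.const_mul M)
  have hint' : Integrable (fun ω => (f' ω + M) * g' ω) P' := by
    simp only [add_mul]
    exact hfg'.add (hgi'.const_mul M)
  have hmain : ∫ ω, (f ω + M) * g ω ∂P ≤ ∫ ω, (f' ω + M) * g' ω ∂P' := by
    have hnn : 0 ≤ᵐ[P] fun ω => (f ω + M) * g ω := by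
      filter_upwards [hf0, hg0] with ω h1 h2 using mul_nonneg h1 h2
    have hnn' : 0 ≤ᵐ[P'] fun ω => (f' ω + M) * g' ω := by
      filter_upwards [hf0', hg0'] with ω h1 h2 using mul_nonneg h1 h2
    have e1 : ∫⁻ ω, ENNReal.ofReal ((f ω + M) * g ω) ∂P =
        ∫⁻ ω, ENNReal.ofReal (f ω + M) * ENNReal.ofReal (g ω) ∂P :=
      lintegral_congr_ae (by filter_upwards [hf0] with ω h using ENNReal.ofReal_mul h)
    have e2 : ∫⁻ ω, ENNReal.ofReal ((f' ω + M) * g' ω) ∂P' =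
        ∫⁻ ω, ENNReal.ofReal (f' ω + M) * ENNReal.ofReal (g' ω) ∂P' :=
      lintegral_congr_ae (by filter_upwards [hf0'] with ω h using ENNReal.ofReal_mul h)
    rw [← ENNReal.ofReal_le_ofReal_iff (integral_nonneg_of_ae hnn'),
      ofReal_integral_eq_lintegral_ofReal hint hnn,
      ofReal_integral_eq_lintegral_ofReal hint' hnn', e1, e2]
    exact hle
  simp only [add_mul] at hmain
  rw [integral_add hfg (hgi.const_mul M), integral_add hfg' (hgi'.const_mul M),
    integral_const_mul, integral_const_mul, hg.integral_eq] at hmain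
  linarith

/-! ### Rearrangements and law invariance -/

theorem measurable_density {P : Measure Ω} (Q : DualMeasure P) : Measurable (density Q) :=
  (Measure.measurable_rnDeriv _ _).ennreal_toReal

theorem density_nonneg {P : Measure Ω} (Q : DualMeasure P) (ω : Ω) : 0 ≤ density Q ω :=
  ENNReal.toReal_nonneg

theorem integrable_density {P : Measure Ω} (Q : DualMeasure P) : Integrable (density Q) P :=
  have := Q.2.1
  Measure.integrable_toReal_rnDeriv

theorem measurable_log_coe {P : Measure Ω} (X : LinfPP P) :
    Measurable fun ω => Real.log (X.1 ω) :=
  Real.measurable_log.comp (Lp.stronglyMeasurable X.1).measurable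

theorem expLog_eq_integral_mul_density {P : Measure Ω} [IsProbabilityMeasure P]
    (Q : DualMeasure P) (X : LinfPP P) :
    expLog Q X = ∫ ω, Real.log (X.1 ω) * density Q ω ∂P := by
  have := Q.2.1
  rw [expLog, ← integral_rnDeriv_smul Q.2.2]
  exact integral_congr_ae (ae_of_all _ fun ω => mul_comm _ _)

theorem expLog_le_of_comonotone {P : Measure Ω} [IsProbabilityMeasure P] {P' : Measure Ω'}
    [IsProbabilityMeasure P'] (Q : DualMeasure P) (X : LinfPP P) {f' g' : Ω' → ℝ}
    (hco : Comonotone P' f' g') (hf : IdentDistrib (fun ω => Real.log (X.1 ω)) f' P P')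
    (hg : IdentDistrib (density Q) g' P P') : expLog Q X ≤ ∫ ω, f' ω * g' ω ∂P' := by
  obtain ⟨M, hM⟩ := exists_ae_abs_le (memLp_log X)
  rw [expLog_eq_integral_mul_density]
  exact hco.integral_mul_le hf hg hM (ae_of_all _ (density_nonneg Q)) (integrable_density Q)

theorem identDistrib_log {P : Measure Ω} {X : LinfPP P} {P' : Measure Ω'} {Y : Ω' → ℝ}
    (h : IdentDistrib X.1 Y P P') :
    IdentDistrib (fun ω => Real.log (X.1 ω)) (fun ω => Real.log (Y ω)) P P' :=
  h.comp Real.measurable_log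

/-- Every element of `L^∞_{++}` has a copy whose logarithm is comonotone with a given variable. -/
theorem NonAtomic.exists_copy_comonotone {P : Measure Ω} [IsProbabilityMeasure P]
    (hP : NonAtomic P) (X : LinfPP P) {g : Ω → ℝ} (hg : Measurable g) :
    ∃ Y : LinfPP P, IdentDistrib X.1 Y.1 P P ∧
      Comonotone P (fun ω => Real.log (Y.1 ω)) g := by
  obtain ⟨f, hf, hco⟩ := hP.exists_comonotone hg (measurable_log_coe X).aemeasurable
  have hfL : MemLp f ∞ P := hf.memLp_snd (memLp_log X)
  refine ⟨ofLog f hfL, ?_, ?_⟩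
  · have h1 : IdentDistrib X.1 (fun ω => Real.exp (Real.log (X.1 ω))) P P :=
      IdentDistrib.of_ae_eq (Lp.stronglyMeasurable X.1).measurable.aemeasurable (by
        filter_upwards [pos_ae X] with ω hω
        rw [Real.exp_log hω])
    have h2 : IdentDistrib (fun ω => Real.exp (f ω)) (ofLog f hfL).1 P P :=
      IdentDistrib.of_ae_eq (Real.measurable_exp.comp_aemeasurable hf.aemeasurable_snd)
        (coeFn_ofLog hfL).symm
    exact (h1.trans (hf.comp Real.measurable_exp)).trans h2
  · obtain ⟨S, hS, h⟩ := hco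
    refine ⟨S ∩ {ω | Real.log ((ofLog f hfL).1 ω) = f ω}, inter_mem hS (log_ofLog hfL), ?_⟩
    rintro ω ⟨hω, e⟩ ω' ⟨hω', e'⟩ hlt
    have e1 : Real.log ((ofLog f hfL).1 ω) = f ω := e
    have e2 : Real.log ((ofLog f hfL).1 ω') = f ω' := e'
    simp only [e1, e2]
    exact h ω hω ω' hω' hlt

/-- Every dual measure has a copy whose density is comonotone with a given variable. -/
theorem NonAtomic.exists_dualMeasure_comonotone {P : Measure Ω} [IsProbabilityMeasure P]
    (hP : NonAtomic P) (Q : DualMeasure P) {f : Ω → ℝ} (hf : Measurable f) :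
    ∃ Q' : DualMeasure P, IdentDistrib (density Q) (density Q') P P ∧
      Comonotone P f (density Q') := by
  obtain ⟨g, hg, hco⟩ := hP.exists_comonotone hf (measurable_density Q).aemeasurable
  have := Q.2.1
  have hg0 : 0 ≤ᵐ[P] g :=
    hg.ae_snd (p := fun x => 0 ≤ x) measurableSet_Ici (ae_of_all _ (density_nonneg Q))
  have hmass : ∫⁻ ω, ENNReal.ofReal (g ω) ∂P = 1 := by
    refine (hg.comp ENNReal.measurable_ofReal).lintegral_eq.symm.trans ?_
    calc ∫⁻ ω, ENNReal.ofReal (density Q ω) ∂P = ∫⁻ ω, Q.1.rnDeriv P ω ∂P :=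
          lintegral_congr_ae (by
            filter_upwards [Q.1.rnDeriv_lt_top P] with ω hω using ENNReal.ofReal_toReal hω.ne)
      _ = 1 := by rw [Measure.lintegral_rnDeriv Q.2.2, measure_univ]
  let Q' : DualMeasure P := ⟨P.withDensity fun ω => ENNReal.ofReal (g ω),
    ⟨by rw [withDensity_apply _ MeasurableSet.univ, Measure.restrict_univ, hmass]⟩,
    withDensity_absolutelyContinuous _ _⟩
  have hden : g =ᵐ[P] density Q' := by
    filter_upwards [Measure.rnDeriv_withDensity₀ P hg.aemeasurable_snd.ennreal_ofReal, hg0]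
      with ω h1 h2
    change g ω = ((P.withDensity fun ω => ENNReal.ofReal (g ω)).rnDeriv P ω).toReal
    rw [h1, ENNReal.toReal_ofReal h2]
  refine ⟨Q', hg.trans (IdentDistrib.of_ae_eq hg.aemeasurable_snd hden), Comonotone.symm ?_⟩
  obtain ⟨S, hS, h⟩ := hco
  refine ⟨S ∩ {ω | g ω = density Q' ω}, inter_mem hS hden, ?_⟩
  rintro ω ⟨hω, e⟩ ω' ⟨hω', e'⟩ hlt
  have e1 : g ω = density Q' ω := e
  have e2 : g ω' = density Q' ω' := e'
  rw [← e1, ← e2]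
  exact h ω hω ω' hω' hlt

/-- A competitor Y for Q is replaced by a copy comonotone with dQ'/dP. By Hardy–Littlewood the copy
competes for Q', and its ρ-value is the same. -/
theorem IsLawInvariant.dualFunction {P : Measure Ω} [IsProbabilityMeasure P]
    (hP : NonAtomic P) {ρ : LinfPP P → ℝ≥0∞} (hρ : IsLawInvariant ρ) :
    IsDualLawInvariant (dualFunction ρ) := by
  have key : ∀ (t : ℝ) (Q Q' : DualMeasure P), IdentDistrib (density Q) (density Q') P P →
      QLC.dualFunction ρ t Q' ≤ QLC.dualFunction ρ t Q := by
    intro t Q Q' hQ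
    refine le_iInf₂ fun Y hY => ?_
    obtain ⟨Y', hY', hco⟩ := hP.exists_copy_comonotone Y (measurable_density Q')
    have h := expLog_le_of_comonotone Q Y hco (identDistrib_log hY') hQ
    rw [← expLog_eq_integral_mul_density] at h
    rw [hρ Y Y' hY']
    exact iInf₂_le (f := fun (Y : LinfPP P) (_ : t ≤ expLog Q' Y) => ρ Y) Y' (hY.trans h)
  exact fun t Q Q' hQ => le_antisymm (key t Q' Q hQ.symm) (key t Q Q' hQ)

/-- Here Q is rearranged: a measure Q' whose density has the same law and is comonotone with log Y
satisfies E_Q log X ≤ E_Q' log Y. -/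
theorem IsRepresentedBy.isLawInvariant {P : Measure Ω} [IsProbabilityMeasure P]
    (hP : NonAtomic P) {ρ : LinfPP P → ℝ≥0∞} (h : IsRepresentedBy ρ (QLC.dualFunction ρ))
    (hR : IsDualLawInvariant (QLC.dualFunction ρ)) : IsLawInvariant ρ := by
  have key : ∀ X Y : LinfPP P, IdentDistrib X.1 Y.1 P P → ρ X ≤ ρ Y := by
    intro X Y hXY
    rw [h X]
    refine iSup_le fun Q => ?_
    obtain ⟨Q', hQ', hco⟩ := hP.exists_dualMeasure_comonotone Q (measurable_log_coe Y)
    have hle := expLog_le_of_comonotone Q X hco (identDistrib_log hXY) hQ'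
    rw [← expLog_eq_integral_mul_density] at hle
    rw [hR _ Q Q' hQ']
    exact (dualFunction_mono ρ Q' hle).trans (dualFunction_expLog_le ρ Y Q')
  exact fun X Y hXY => le_antisymm (key X Y hXY) (key Y X hXY.symm)

/-! ### The quantile form of the dual function -/

theorem isProbabilityMeasure_volume_Ioo :
    IsProbabilityMeasure (volume.restrict (Ioo (0 : ℝ) 1)) := ⟨by simp⟩

section Quantile

variable {P : Measure Ω} [IsProbabilityMeasure P] {Y : LinfPP P} {Q : DualMeasure P}
  {q d : ℝ → ℝ}

theorem identDistrib_quantile (hq : IsQuantileFunction P Y.1 q) :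
    IdentDistrib Y.1 q P (volume.restrict (Ioo 0 1)) :=
  hq.identDistrib (Lp.stronglyMeasurable Y.1).measurable.aemeasurable

theorem identDistrib_quantile_density (hd : IsQuantileFunction P (density Q) d) :
    IdentDistrib (density Q) d P (volume.restrict (Ioo 0 1)) :=
  hd.identDistrib (measurable_density Q).aemeasurable

theorem quantileIntegral_eq :
    quantileIntegral q d = ∫ β, Real.log (q β) * d β ∂volume.restrict (Ioo (0 : ℝ) 1) := by
  rw [quantileIntegral, intervalIntegral.integral_of_le zero_le_one, integral_Ioc_eq_integral_Ioo]

theorem intervalIntegrable_quantile (hq : IsQuantileFunction P Y.1 q)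
    (hd : IsQuantileFunction P (density Q) d) :
    IntervalIntegrable (fun β => Real.log (q β) * d β) volume 0 1 := by
  rw [intervalIntegrable_iff_integrableOn_Ioo_of_le zero_le_one]
  have hlog := identDistrib_log (identDistrib_quantile hq)
  obtain ⟨M, hM⟩ := exists_ae_abs_le (memLp_log Y)
  exact integrable_mul_of_bounded hlog.aemeasurable_snd
    (hlog.ae_snd (p := fun x => |x| ≤ M) (measurableSet_le measurable_id.abs measurable_const) hM)
    ((identDistrib_quantile_density hd).integrable_snd (integrable_density Q))

/-- Quantile functions are comonotone copies on (0,1), so this is Hardy–Littlewood with a different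
target space. -/
theorem expLog_le_quantileIntegral (hq : IsQuantileFunction P Y.1 q)
    (hd : IsQuantileFunction P (density Q) d) : expLog Q Y ≤ quantileIntegral q d := by
  have := isProbabilityMeasure_volume_Ioo
  rw [quantileIntegral_eq]
  refine expLog_le_of_comonotone Q Y ?_ (identDistrib_log (identDistrib_quantile hq))
    (identDistrib_quantile_density hd)
  obtain ⟨S, hS, h⟩ := hq.comonotone hd
  have hpos : ∀ᵐ β ∂volume.restrict (Ioo (0 : ℝ) 1), 0 < q β :=
    (identDistrib_quantile hq).ae_snd (p := fun x => 0 < x) measurableSet_Ioi (pos_ae Y)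
  exact ⟨S ∩ {β | 0 < q β}, inter_mem hS hpos, fun a ha b hb hlt =>
    Real.log_le_log ha.2 (h a ha.1 b hb.1 hlt)⟩

/-- Hardy–Littlewood in the reverse direction, from (0,1) to Ω: the maximum is attained by a copy
comonotone with the density. -/
theorem exists_quantileIntegral_le_expLog (hP : NonAtomic P) (hq : IsQuantileFunction P Y.1 q)
    (hd : IsQuantileFunction P (density Q) d) :
    ∃ Y' : LinfPP P, IdentDistrib Y.1 Y'.1 P P ∧ quantileIntegral q d ≤ expLog Q Y' := by
  have := isProbabilityMeasure_volume_Ioo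
  obtain ⟨Y', hY', hco⟩ := hP.exists_copy_comonotone Y (measurable_density Q)
  refine ⟨Y', hY', ?_⟩
  rw [quantileIntegral_eq, expLog_eq_integral_mul_density]
  have hq' := identDistrib_quantile hq
  have hd' := identDistrib_quantile_density hd
  obtain ⟨M, hM⟩ := exists_ae_abs_le (memLp_log Y)
  exact hco.integral_mul_le ((identDistrib_log hq').symm.trans (identDistrib_log hY')) hd'.symm
    ((identDistrib_log hq').ae_snd (p := fun x => |x| ≤ M)
      (measurableSet_le measurable_id.abs measurable_const) hM)
    (hd'.ae_snd (p := fun x => 0 ≤ x) measurableSet_Ici (ae_of_all _ (density_nonneg Q)))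
    (hd'.integrable_snd (integrable_density Q))

end Quantile

/-- The quantile constraint is weaker for each Y, but a Y satisfying it has a copy that satisfies
the original one at the same ρ-value. -/
theorem quantileDual_eq_dualFunction {P : Measure Ω} [IsProbabilityMeasure P]
    (hP : NonAtomic P) {ρ : LinfPP P → ℝ≥0∞} (hρ : IsLawInvariant ρ) {qV : LinfPP P → ℝ → ℝ}
    {qD : DualMeasure P → ℝ → ℝ} (hqV : ∀ Y : LinfPP P, IsQuantileFunction P Y.1 (qV Y))
    (hqD : ∀ Q : DualMeasure P, IsQuantileFunction P (density Q) (qD Q)) (t : ℝ)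
    (Q : DualMeasure P) : quantileDual ρ qV qD t Q = QLC.dualFunction ρ t Q := by
  refine le_antisymm (le_iInf₂ fun Y hY => ?_) (le_iInf₂ fun Y hY => ?_)
  · exact iInf₂_le (f := fun (Y : LinfPP P) (_ : t ≤ quantileIntegral (qV Y) (qD Q)) => ρ Y) Y
      (hY.trans (expLog_le_quantileIntegral (hqV Y) (hqD Q)))
  · obtain ⟨Y', hY', hle⟩ := exists_quantileIntegral_le_expLog hP (hqV Y) (hqD Q)
    rw [hρ Y Y' hY']
    exact iInf₂_le (f := fun (Y : LinfPP P) (_ : t ≤ expLog Q Y) => ρ Y) Y' (hY.trans hle)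

end QLC

theorem mainTheorem4 {Ω : Type*} [MeasurableSpace Ω] (P : Measure Ω) [IsProbabilityMeasure P]
    (hP : QLC.NonAtomic P) (ρ : QLC.LinfPP P → ℝ≥0∞) :
    -- (a) the representation, and law invariance of `ρ` versus that of its dual function
    (QLC.IsMonotone ρ → QLC.IsQuasiLogconvex ρ → QLC.IsContinuousFromBelow ρ →
      QLC.IsRepresentedBy ρ (QLC.dualFunction ρ) ∧
      (QLC.IsLawInvariant ρ ↔ QLC.IsDualLawInvariant (QLC.dualFunction ρ))) ∧
    -- (a) converse, without presupposing any property of `ρ` but its being represented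
    (QLC.IsRepresentedBy ρ (QLC.dualFunction ρ) →
      QLC.IsDualLawInvariant (QLC.dualFunction ρ) →
      QLC.IsMonotone ρ ∧ QLC.IsQuasiLogconvex ρ ∧ QLC.IsLawInvariant ρ ∧
        (QLC.IsDualContinuousFromBelow (QLC.dualFunction ρ) →
          QLC.IsContinuousFromBelow ρ)) ∧
    -- (b) the quantile representation
    (QLC.IsMonotone ρ → QLC.IsQuasiLogconvex ρ → QLC.IsContinuousFromBelow ρ →
      QLC.IsLawInvariant ρ →
      ∀ (qV : QLC.LinfPP P → ℝ → ℝ) (qD : QLC.DualMeasure P → ℝ → ℝ),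
        (∀ Y : QLC.LinfPP P, QLC.IsQuantileFunction P Y.1 (qV Y)) →
        (∀ Q : QLC.DualMeasure P, QLC.IsQuantileFunction P (QLC.density Q) (qD Q)) →
        (∀ (Y : QLC.LinfPP P) (Q : QLC.DualMeasure P),
          IntervalIntegrable (fun β => Real.log (qV Y β) * qD Q β) volume 0 1) ∧
        (∀ X : QLC.LinfPP P,
          ρ X = ⨆ Q : QLC.DualMeasure P,
            QLC.quantileDual ρ qV qD (QLC.quantileIntegral (qV X) (qD Q)) Q) ∧
        (∀ (t : ℝ) (Q : QLC.DualMeasure P),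
          QLC.quantileDual ρ qV qD t Q = QLC.dualFunction ρ t Q) ∧
        QLC.IsDualLawInvariant (QLC.quantileDual ρ qV qD)) := by
  refine ⟨fun h1 h2 h3 => ?_, fun h1 h2 => ?_, fun h1 h2 h3 h4 qV qD hqV hqD => ?_⟩
  · have hrep := QLC.isRepresentedBy_dualFunction h1 h2 h3
    exact ⟨hrep, fun h => h.dualFunction hP, fun h => hrep.isLawInvariant hP h⟩
  · exact ⟨h1.isMonotone, h1.isQuasiLogconvex, h1.isLawInvariant hP h2,
      h1.isContinuousFromBelow⟩
  · have heq := QLC.quantileDual_eq_dualFunction hP h4 hqV hqD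
    refine ⟨fun Y Q => QLC.intervalIntegrable_quantile (hqV Y) (hqD Q), fun X => ?_, heq,
      fun t Q Q' hQ => ?_⟩
    -- The quantile integral dominates E_Q log X, so monotonicity in t gives one inequality. For the
    -- other, X itself competes in the quantile infimum.
    · refine le_antisymm ?_ (iSup_le fun Q => ?_)
      · rw [QLC.isRepresentedBy_dualFunction h1 h2 h3 X]
        refine iSup_mono fun Q => ?_
        rw [heq]
        exact QLC.dualFunction_mono ρ Q (QLC.expLog_le_quantileIntegral (hqV X) (hqD Q))
      · exact iInf₂_le (f := fun (Y : QLC.LinfPP P) (_ : QLC.quantileIntegral (qV X) (qD Q) ≤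
          QLC.quantileIntegral (qV Y) (qD Q)) => ρ Y) X le_rfl
    · rw [heq, heq]
      exact h4.dualFunction hP t Q Q' hQ
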